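/- Let $\mathcal P$ be a class of data generating processes. Each $P\in\mathcal P$ has parameters of interest $\mu_1,\mu_2\in\mathbb R$ and nuisance parameters $\sigma_1,\sigma_2>0$, $\rho\in[-1,1]$ (all depending on $P$), and determines, for every $n$, the law $\Pr_P$ of a sample of size $n$. Assume that for at least one value of $(\sigma_1,\sigma_2,\rho)$ every pair $(\mu_1,\mu_2)$ with $\mu_1\mu_2\ge 0$ occurs in $\mathcal P$ together with that value. Let $\hat\mu_1,\hat\mu_2,\hat\sigma_1,\hat\sigma_2,\hat\rho$ be estimators (measurable functions of the sample of size $n$), with $\hat\rho\in[-1,1]$, such that, as $n\to\infty$, uniformly over $P\in\mathcal P$, $$\sqrt n\begin{pmatrix}\hat\mu_1-\mu_1\\ \hat\mu_2-\mu_2\end{pmatrix}\overset{d}{\to}\mathcal N\left(0,\begin{pmatrix}\sigma_1^2&\rho\sigma_1\sigma_2\\ \rho\sigma_1\sigma_2&\sigma_2^2\end{pmatrix}\right),\qquad \frac{\hat\sigma_1}{\sigma_1}\overset{p}{\to}1,\quad \frac{\hat\sigma_2}{\sigma_2}\overset{p}{\to}1,\quad \hat\rho-\rho\overset{p}{\to}0,$$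 where uniform convergence in distribution means that the supremum, over $P\in\mathcal P$ and over $t\in\mathbb R^2$, of the distance between the two joint distribution functions at $t$ tends to $0$, and uniform convergence in probability means that $\sup_{P\in\mathcal P}\Pr_P(|\cdot|\ge\varepsilon)\to0$ for the deviation from the limit and every $\varepsilon>0$. Let $0<\alpha<1/2$. The feasible test rejects $H_0:\mu_1\mu_2\ge0$ if $$\hat\mu_1\hat\mu_2<0\quad\text{and}\quad \sqrt n\,\min\{|\hat\mu_1|/\hat\sigma_1,\ |\hat\mu_2|/\hat\sigma_2\}\ \ge\ \hat c_\alpha ,\qquad (*)$$ where: (i) if it is known that $\rho\ge0$ (that is, $\rho\ge 0$ for every $P\in\mathcal P$), $\hat c_\alpha=\Phi^{-1}(1-\alpha)$, with $\Phi$ the standard normal distribution function; (ii) in general, $\hat c_\alpha$ is the solution $c$ of the equation below at $r=\hat\rho$: $$\sup_{m\ge0}\Pr\bigl(X_1(m+X_2)<0,\ \min\{|X_1|,|m+X_2|\}>c\bigr)=\alpha,\qquad \begin{pmatrix}X_1\\X_2\end{pmatrix}\sim\mathcal N\left(0,\begin{pmatrix}1&r\\ r&1\end{pmatrix}\right).$$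 Then for every $r\in[-1,1]$ the equation in (ii) has exactly one real solution $c$, and, with the critical value of (i) if $\rho\ge 0$ is known, as well as with the critical value of (ii) in general, the feasible test is nonconservatively uniformly asymptotically valid: $$\lim_{n\to\infty}\ \sup_{P\in\mathcal P:\ \mu_1\mu_2\ge0}\Pr\nolimits_P\bigl((*)\text{ obtains}\bigr)=\alpha .$$ -/

import Mathlib

open MeasureTheory ProbabilityTheory Filter Topology

noncomputable section

namespace SignCongruence

/-- The matrix with diagonal entries `s₁²`, `s₂²` and off-diagonal entries `r s₁ s₂`. -/
def covMatrix (s₁ s₂ r : ℝ) : Matrix (Fin 2) (Fin 2) ℝ :=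
  !![s₁ ^ 2, r * s₁ * s₂; r * s₁ * s₂, s₂ ^ 2]

/-- For `|r| ≤ 1` the matrix `covMatrix s₁ s₂ r` is a genuine covariance matrix, so that
Mathlib's Gaussian measure below is the Gaussian law with that covariance. -/
theorem covMatrix_posSemidef (s₁ s₂ r : ℝ) (hr : |r| ≤ 1) : (covMatrix s₁ s₂ r).PosSemidef := by
  have hr2 : r ^ 2 ≤ 1 := by
    have := sq_le_one_iff_abs_le_one r
    exact this.mpr hr
  refine Matrix.PosSemidef.of_dotProduct_mulVec_nonneg ?_ ?_
  · ext i j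
    fin_cases i <;> fin_cases j <;> simp [covMatrix]
  · intro x
    simp [covMatrix, dotProduct, Matrix.mulVec, Fin.sum_univ_two]
    nlinarith [sq_nonneg (x 0 * s₁ + r * (x 1 * s₂)),
      mul_nonneg (sub_nonneg.mpr hr2) (sq_nonneg (x 1 * s₂))]

/-- The centred bivariate normal law `N(0, covMatrix s₁ s₂ r)`. -/
def bivariateNormal (s₁ s₂ r : ℝ) : Measure (EuclideanSpace ℝ (Fin 2)) :=
  multivariateGaussian 0 (covMatrix s₁ s₂ r)

/-- The quantile function `Φ⁻¹` of the standard normal law. -/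
def stdNormalQuantile (p : ℝ) : ℝ :=
  sInf {x : ℝ | p ≤ cdf (gaussianReal 0 1) x}

/-- The defining equation of the critical value `c` at level `α` and correlation `r`:
`sup_{m ≥ 0} Pr(X₁ (m + X₂) < 0, min{|X₁|, |m + X₂|} > c) = α`, where `(X₁, X₂)` is
bivariate normal with zero means, unit variances and correlation `r`. -/
def IsCriticalValue (α r c : ℝ) : Prop :=
  (⨆ (m : ℝ) (_ : 0 ≤ m), bivariateNormal 1 1 r
    {x | x 0 * (m + x 1) < 0 ∧ c < min |x 0| |m + x 1|}) = ENNReal.ofReal α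

/-- A class `DGP` of data generating processes: under `P ∈ DGP`, the sample of size `n`, an
element of `Ω n`, has law `law P n`; attached to `P` are the parameters of interest
`μ₁, μ₂` and the nuisance parameters `σ₁, σ₂ > 0` and `ρ ∈ [-1, 1]`. -/
structure StatModel (DGP : Type*) (Ω : ℕ → Type*) [∀ n, MeasurableSpace (Ω n)] where
  law : DGP → (n : ℕ) → Measure (Ω n)
  isProbabilityMeasure_law : ∀ P n, IsProbabilityMeasure (law P n)
  μ₁ : DGP → ℝ
  μ₂ : DGP → ℝ
  σ₁ : DGP → ℝ
  σ₂ : DGP → ℝ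
  ρ : DGP → ℝ
  σ₁_pos : ∀ P, 0 < σ₁ P
  σ₂_pos : ∀ P, 0 < σ₂ P
  abs_ρ_le_one : ∀ P, |ρ P| ≤ 1

/-- Estimators of the five parameters: measurable functions of the sample of size `n`, where
the estimated correlation takes values in `[-1, 1]`. -/
structure Estimators (Ω : ℕ → Type*) [∀ n, MeasurableSpace (Ω n)] where
  μ₁ : (n : ℕ) → Ω n → ℝ
  μ₂ : (n : ℕ) → Ω n → ℝ
  σ₁ : (n : ℕ) → Ω n → ℝ
  σ₂ : (n : ℕ) → Ω n → ℝ
  ρ : (n : ℕ) → Ω n → ℝ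
  measurable_μ₁ : ∀ n, Measurable (μ₁ n)
  measurable_μ₂ : ∀ n, Measurable (μ₂ n)
  measurable_σ₁ : ∀ n, Measurable (σ₁ n)
  measurable_σ₂ : ∀ n, Measurable (σ₂ n)
  measurable_ρ : ∀ n, Measurable (ρ n)
  abs_ρ_le_one : ∀ n ω, |ρ n ω| ≤ 1

section

variable {DGP : Type*} {Ω : ℕ → Type*} [∀ n, MeasurableSpace (Ω n)]

/-- Uniform central limit theorem: the joint distribution function of
`√n (μ̂₁ - μ₁, μ̂₂ - μ₂)` converges to that of `N(0, covMatrix σ₁ σ₂ ρ)`, uniformly over `DGP`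
and over the argument `(t₁, t₂)` of the distribution function. -/
def UniformCLT (M : StatModel DGP Ω) (E : Estimators Ω) : Prop :=
  ∀ ε : ℝ, 0 < ε → ∀ᶠ n : ℕ in atTop, ∀ (P : DGP) (t₁ t₂ : ℝ),
    |(M.law P n).real {ω | √(n : ℝ) * (E.μ₁ n ω - M.μ₁ P) ≤ t₁ ∧
        √(n : ℝ) * (E.μ₂ n ω - M.μ₂ P) ≤ t₂}
      - (bivariateNormal (M.σ₁ P) (M.σ₂ P) (M.ρ P)).real {x | x 0 ≤ t₁ ∧ x 1 ≤ t₂}| < ε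

/-- Convergence to zero in probability of `Y P n`, uniformly over the class `DGP`. -/
def TendstoZeroInProbUniformly (M : StatModel DGP Ω) (Y : DGP → (n : ℕ) → Ω n → ℝ) : Prop :=
  ∀ ε : ℝ, 0 < ε →
    Tendsto (fun n : ℕ => ⨆ P : DGP, M.law P n {ω | ε ≤ |Y P n ω|}) atTop (𝓝 0)

/-- Uniform consistency of the estimators of `σ₁`, `σ₂` (in ratio) and `ρ`. -/
def UniformlyConsistent (M : StatModel DGP Ω) (E : Estimators Ω) : Prop :=
  TendstoZeroInProbUniformly M (fun P n ω => E.σ₁ n ω / M.σ₁ P - 1) ∧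
  TendstoZeroInProbUniformly M (fun P n ω => E.σ₂ n ω / M.σ₂ P - 1) ∧
  TendstoZeroInProbUniformly M (fun P n ω => E.ρ n ω - M.ρ P)

/-- The event that the feasible test with (possibly data dependent) critical value `c n`
rejects in a sample of size `n`. -/
def rejectionEvent (E : Estimators Ω) (c : (n : ℕ) → Ω n → ℝ) (n : ℕ) : Set (Ω n) :=
  {ω | E.μ₁ n ω * E.μ₂ n ω < 0 ∧
    c n ω ≤ √(n : ℝ) * min (|E.μ₁ n ω| / E.σ₁ n ω) (|E.μ₂ n ω| / E.σ₂ n ω)}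

/-- The size of the feasible test at sample size `n`: the supremum of its rejection probability
over all data generating processes with `μ₁ μ₂ ≥ 0`. -/
def testSize (M : StatModel DGP Ω) (E : Estimators Ω) (c : (n : ℕ) → Ω n → ℝ) (n : ℕ) :
    ENNReal :=
  ⨆ (P : DGP) (_ : 0 ≤ M.μ₁ P * M.μ₂ P), M.law P n (rejectionEvent E c n)

/-- The means range over the whole null hypothesis: for at least one value of the nuisance
parameters, every `(m₁, m₂)` with `m₁ m₂ ≥ 0` is the mean of some member of the class. -/
def CoversNull (M : StatModel DGP Ω) : Prop :=
  ∃ s₁ s₂ r : ℝ, ∀ m₁ m₂ : ℝ, 0 ≤ m₁ * m₂ →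
    ∃ P : DGP, M.μ₁ P = m₁ ∧ M.μ₂ P = m₂ ∧ M.σ₁ P = s₁ ∧ M.σ₂ P = s₂ ∧ M.ρ P = r

end

end SignCongruence

end

/-! In local parameters hᵢ = √n μᵢ/σᵢ the test rejects, up to small errors, when h + X lies in one
of two opposite quadrants at distance c from the axes, X being standard bivariate normal with
correlation ρ. Each quadrant probability is a combination of values of the distribution function and
its marginals, so the uniform CLT controls it uniformly in P and h. The Gaussian probability `power
ρ h₁ h₂ c` is Lipschitz in c uniformly in h, so estimating σ₁, σ₂, ρ only perturbs c harmlessly.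
This gives `eventually_abs_rejection_sub_power_le`.

It remains to maximize `power` over h₁h₂ ≥ 0. By symmetry take 0 ≤ h₁ ≤ h₂. Lowering h₁ to 0 loses a
strip of one quadrant and gains a strip of the other; a volume-preserving map sends the lost strip
into the gained one and brings every point closer to the origin, where the density is larger
(`stdPair_strip_le`). So the worst case is `maxPower`, the supremum over h = (0, m) in the equation
for c. For ρ ≥ 0 a reflection shows that it equals Pr(X₁ < -c), whence the normal quantile.

`maxPower` is continuous in c and strictly decreasing for c ≥ 0, and it varies continuously with the
correlation. Hence the critical value is unique and continuous in r, and plugging in the estimate is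
harmless. The size is not below α in the limit, because `CoversNull` supplies processes with h = (0,
m) for every m ≥ 0. -/

namespace SignCongruence

/-! ### Linear images and density bounds of Gaussian laws. -/

section GaussianFacts

open Matrix

theorem map_multivariateGaussian_toEuclideanCLM {ι : Type*} [Fintype ι] [DecidableEq ι]
    {S : Matrix ι ι ℝ} (hS : S.PosSemidef) (B : Matrix ι ι ℝ) :
    (multivariateGaussian 0 S).map (toEuclideanCLM (𝕜 := ℝ) B)
      = multivariateGaussian 0 (B * S * Bᵀ) := by
  have hBS : (B * S * Bᵀ).PosSemidef := by
    simpa using hS.mul_mul_conjTranspose_same B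
  apply Measure.ext_of_charFun
  ext t
  have key : ∀ x : EuclideanSpace ℝ ι, inner ℝ (toEuclideanCLM (𝕜 := ℝ) B x) t
      = inner ℝ x (toEuclideanCLM (𝕜 := ℝ) Bᵀ t) := fun x => by
    rw [real_inner_comm, inner_toEuclideanCLM, inner_toEuclideanCLM, dotProduct_mulVec,
      dotProduct_comm, mulVec_transpose]
  have : charFun ((multivariateGaussian 0 S).map (toEuclideanCLM (𝕜 := ℝ) B)) t
      = charFun (multivariateGaussian 0 S) (toEuclideanCLM (𝕜 := ℝ) Bᵀ t) := by
    rw [charFun_apply, charFun_apply, integral_map (by fun_prop) (by fun_prop)]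
    simp_rw [key]
  rw [this, charFun_multivariateGaussian hS, charFun_multivariateGaussian hBS]
  simp only [ofLp_toEuclideanCLM, inner_zero_right]
  congr 4
  rw [dotProduct_mulVec, dotProduct_mulVec, mulVec_transpose, vecMul_vecMul, vecMul_vecMul,
    dotProduct_mulVec, Matrix.mul_assoc]

/-- The linear map turning two independent standard normal variables into a standard bivariate
normal pair with correlation `r`. -/
noncomputable def correlate (r : ℝ) (p : ℝ × ℝ) : EuclideanSpace ℝ (Fin 2) :=
  !₂[p.1, r * p.1 + √(1 - r ^ 2) * p.2]

@[simp] theorem correlate_zero (r : ℝ) (p : ℝ × ℝ) : correlate r p 0 = p.1 := rfl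

@[simp] theorem correlate_one (r : ℝ) (p : ℝ × ℝ) :
    correlate r p 1 = r * p.1 + √(1 - r ^ 2) * p.2 := rfl

theorem continuous_correlate (r : ℝ) : Continuous (correlate r) := by
  unfold correlate; fun_prop

theorem one_sub_sq_nonneg {r : ℝ} (hr : |r| ≤ 1) : 0 ≤ 1 - r ^ 2 := by
  have := (sq_le_one_iff_abs_le_one r).2 hr
  linarith

/-- The law of two independent standard normal variables. -/
noncomputable abbrev stdPair : Measure (ℝ × ℝ) := (gaussianReal 0 1).prod (gaussianReal 0 1)

/-- Cholesky factorization of the correlation matrix. It includes the degenerate cases r = ±1, and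
puts all correlations on one probability space, which serves as a coupling. -/
theorem map_stdPair_correlate {r : ℝ} (hr : |r| ≤ 1) :
    stdPair.map (correlate r) = bivariateNormal 1 1 r := by
  have hs := Real.sq_sqrt (one_sub_sq_nonneg hr)
  have h1 : stdPair.map (fun p => !₂[p.1, p.2]) = multivariateGaussian 0 1 := by
    rw [multivariateGaussian_zero_one, ← map_pi_eq_stdGaussian,
      ← (measurePreserving_finTwoArrow (gaussianReal 0 1)).symm.map_eq,
      Measure.map_map (by fun_prop) (by fun_prop)]
    rfl
  have h2 : bivariateNormal 1 1 r = (multivariateGaussian 0 1).map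
      (toEuclideanCLM (𝕜 := ℝ) !![1, 0; r, √(1 - r ^ 2)]) := by
    rw [map_multivariateGaussian_toEuclideanCLM PosSemidef.one, bivariateNormal]
    congr 1
    ext i j
    fin_cases i <;> fin_cases j <;> simp [covMatrix, Matrix.mul_apply, Fin.sum_univ_two]
    linarith
  rw [h2, ← h1, Measure.map_map (by fun_prop) (by fun_prop)]
  congr 1
  ext p i
  fin_cases i <;> simp [correlate, mul_comm]

instance (s₁ s₂ r : ℝ) : IsProbabilityMeasure (bivariateNormal s₁ s₂ r) := by
  unfold bivariateNormal; infer_instance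

theorem map_bivariateNormal {s₁ s₂ r t₁ t₂ u : ℝ} (hr : |r| ≤ 1)
    (B : Matrix (Fin 2) (Fin 2) ℝ) (hB : B * covMatrix s₁ s₂ r * Bᵀ = covMatrix t₁ t₂ u) :
    (bivariateNormal s₁ s₂ r).map (toEuclideanCLM (𝕜 := ℝ) B) = bivariateNormal t₁ t₂ u := by
  rw [bivariateNormal, map_multivariateGaussian_toEuclideanCLM (covMatrix_posSemidef _ _ _ hr), hB,
    bivariateNormal]

theorem measurePreserving_of_matrix {s₁ s₂ r t₁ t₂ u : ℝ} (hr : |r| ≤ 1)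
    (B : Matrix (Fin 2) (Fin 2) ℝ) (hB : B * covMatrix s₁ s₂ r * Bᵀ = covMatrix t₁ t₂ u) :
    MeasurePreserving (fun x : EuclideanSpace ℝ (Fin 2) =>
      !₂[B 0 0 * x 0 + B 0 1 * x 1, B 1 0 * x 0 + B 1 1 * x 1])
      (bivariateNormal s₁ s₂ r) (bivariateNormal t₁ t₂ u) := by
  refine ⟨by fun_prop, ?_⟩
  rw [← map_bivariateNormal hr B hB]
  congr 1
  ext p i
  fin_cases i <;> simp [Matrix.mulVec, dotProduct, Fin.sum_univ_two]

theorem measurePreserving_swap_bivariateNormal {r : ℝ} (hr : |r| ≤ 1) :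
    MeasurePreserving (fun x : EuclideanSpace ℝ (Fin 2) => !₂[x 1, x 0])
      (bivariateNormal 1 1 r) (bivariateNormal 1 1 r) := by
  simpa using measurePreserving_of_matrix (s₁ := 1) (s₂ := 1) (t₁ := 1) (t₂ := 1) (u := r) hr
    !![0, 1; 1, 0] (by
      ext i j
      fin_cases i <;> fin_cases j <;> simp [covMatrix, Matrix.mul_apply, Fin.sum_univ_two])

theorem measurePreserving_neg_bivariateNormal {r : ℝ} (hr : |r| ≤ 1) :
    MeasurePreserving (fun x : EuclideanSpace ℝ (Fin 2) => !₂[-x 0, -x 1])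
      (bivariateNormal 1 1 r) (bivariateNormal 1 1 r) := by
  simpa using measurePreserving_of_matrix (s₁ := 1) (s₂ := 1) (t₁ := 1) (t₂ := 1) (u := r) hr
    !![-1, 0; 0, -1] (by
      ext i j
      fin_cases i <;> fin_cases j <;> simp [covMatrix, Matrix.mul_apply, Fin.sum_univ_two])

theorem measurePreserving_scale_bivariateNormal (s₁ s₂ : ℝ) {r : ℝ} (hr : |r| ≤ 1) :
    MeasurePreserving (fun x : EuclideanSpace ℝ (Fin 2) => !₂[s₁ * x 0, s₂ * x 1])
      (bivariateNormal 1 1 r) (bivariateNormal s₁ s₂ r) := by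
  simpa using measurePreserving_of_matrix (s₁ := 1) (s₂ := 1) (t₁ := s₁) (t₂ := s₂) (u := r) hr
    !![s₁, 0; 0, s₂] (by
      ext i j
      fin_cases i <;> fin_cases j <;>
        simp [covMatrix, Matrix.mul_apply, Fin.sum_univ_two, sq, mul_comm, mul_left_comm])

theorem measurePreserving_eval_bivariateNormal {r : ℝ} (hr : |r| ≤ 1) (i : Fin 2) :
    MeasurePreserving (fun x : EuclideanSpace ℝ (Fin 2) => x i)
      (bivariateNormal 1 1 r) (gaussianReal 0 1) := by
  have := measurePreserving_eval_multivariateGaussian (μ := 0)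
    (covMatrix_posSemidef 1 1 r hr) (i := i)
  fin_cases i <;> simpa [covMatrix, bivariateNormal] using this

theorem gaussianPDFReal_zero_one_le_half (x : ℝ) : gaussianPDFReal 0 1 x ≤ 1 / 2 := by
  have h2 : (2 : ℝ) ≤ √(2 * Real.pi) := by
    apply Real.le_sqrt_of_sq_le
    have := Real.pi_gt_three
    nlinarith
  have h3 : Real.exp (-(x - 0) ^ 2 / (2 * (1 : NNReal))) ≤ 1 := by
    rw [Real.exp_le_one_iff]
    have := sq_nonneg (x - 0)
    simp only [NNReal.coe_one]
    linarith
  rw [gaussianPDFReal]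
  calc _ ≤ (2 : ℝ)⁻¹ * 1 := by
        gcongr
        simpa using h2
    _ = 1 / 2 := by norm_num

theorem gaussianReal_real_Icc_le {a b : ℝ} (hab : a ≤ b) :
    (gaussianReal 0 1).real (Set.Icc a b) ≤ (b - a) / 2 := by
  rw [measureReal_def, gaussianReal_apply_eq_integral _ one_ne_zero]
  rw [ENNReal.toReal_ofReal (integral_nonneg fun x => gaussianPDFReal_nonneg _ _ _)]
  calc ∫ x in Set.Icc a b, gaussianPDFReal 0 1 x ≤ ∫ x in Set.Icc a b, (1 / 2 : ℝ) := by
        apply integral_mono ((integrable_gaussianPDFReal 0 1).integrableOn) (by simp)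
        exact gaussianPDFReal_zero_one_le_half
    _ = _ := by simp [hab]; ring

instance : NullSingletonClass (gaussianReal 0 1) := nullSingletonClass_gaussianReal one_ne_zero

instance : (gaussianReal 0 1).IsOpenPosMeasure :=
  (gaussianReal_absolutelyContinuous' 0 one_ne_zero).isOpenPosMeasure

end GaussianFacts

/-! ### Gaussian rejection probabilities: regularity, symmetry, and supremum over the boundary. -/

section Power

/-- The event that both coordinates of the shifted vector `h + x` exceed `c` in absolute value and
have opposite signs. -/
def rejectSet (h₁ h₂ c : ℝ) : Set (EuclideanSpace ℝ (Fin 2)) :=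
  {x | (h₁ + x 0) * (h₂ + x 1) < 0 ∧ c < min |h₁ + x 0| |h₂ + x 1|}

theorem measurableSet_rejectSet (h₁ h₂ c : ℝ) : MeasurableSet (rejectSet h₁ h₂ c) := by
  rw [rejectSet, Set.ofPred_and]
  exact (measurableSet_lt (by fun_prop) (by fun_prop)).inter
    (measurableSet_lt (by fun_prop) (by fun_prop))

/-- For `c ≥ 0`, rejection means lying in one of two opposite quadrants. -/
theorem mem_rejectSet_iff {h₁ h₂ c : ℝ} (hc : 0 ≤ c) (x : EuclideanSpace ℝ (Fin 2)) :
    x ∈ rejectSet h₁ h₂ c ↔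
      (c < h₁ + x 0 ∧ h₂ + x 1 < -c) ∨ (h₁ + x 0 < -c ∧ c < h₂ + x 1) := by
  simp only [rejectSet, Set.mem_ofPred_eq, mul_neg_iff, lt_min_iff, lt_abs]
  constructor
  · rintro ⟨h | h, h1 | h1, h2 | h2⟩
    all_goals first
      | exact Or.inl ⟨by linarith, by linarith⟩
      | exact Or.inr ⟨by linarith, by linarith⟩
  · rintro (⟨h, h'⟩ | ⟨h, h'⟩)
    · exact ⟨Or.inl ⟨by linarith, by linarith⟩, Or.inl h, Or.inr (by linarith)⟩
    · exact ⟨Or.inr ⟨by linarith, by linarith⟩, Or.inr (by linarith), Or.inl h'⟩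

/-- The asymptotic rejection probability at local parameters `h₁`, `h₂` and correlation `r` of the
test with critical value `c`. -/
noncomputable def power (r h₁ h₂ c : ℝ) : ℝ := (bivariateNormal 1 1 r).real (rejectSet h₁ h₂ c)

theorem power_eq_stdPair {r : ℝ} (hr : |r| ≤ 1) (h₁ h₂ c : ℝ) :
    power r h₁ h₂ c = stdPair.real (correlate r ⁻¹' rejectSet h₁ h₂ c) := by
  rw [power, ← map_stdPair_correlate hr, map_measureReal_apply (continuous_correlate r).measurable
    (measurableSet_rejectSet _ _ _)]

theorem power_nonneg (r h₁ h₂ c : ℝ) : 0 ≤ power r h₁ h₂ c := measureReal_nonneg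

theorem power_le_one (r h₁ h₂ c : ℝ) : power r h₁ h₂ c ≤ 1 := measureReal_le_one

theorem power_swap {r : ℝ} (hr : |r| ≤ 1) (h₁ h₂ c : ℝ) :
    power r h₂ h₁ c = power r h₁ h₂ c := by
  rw [power, power, ← (measurePreserving_swap_bivariateNormal hr).measureReal_preimage
    (measurableSet_rejectSet _ _ _).nullMeasurableSet]
  congr 1
  ext x
  simp [rejectSet, mul_comm, and_comm]

theorem power_neg {r : ℝ} (hr : |r| ≤ 1) (h₁ h₂ c : ℝ) :
    power r (-h₁) (-h₂) c = power r h₁ h₂ c := by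
  rw [power, power, ← (measurePreserving_neg_bivariateNormal hr).measureReal_preimage
    (measurableSet_rejectSet _ _ _).nullMeasurableSet]
  congr 1
  ext x
  have h (a b : ℝ) : -a + -b = -(a + b) := (neg_add a b).symm
  simp only [rejectSet, Set.mem_preimage, Set.mem_ofPred_eq, Matrix.cons_val_zero,
    Matrix.cons_val_one, h, neg_mul_neg, abs_neg]

theorem rejectSet_antitone (h₁ h₂ : ℝ) : Antitone (rejectSet h₁ h₂) :=
  fun _ _ hc _ hx => ⟨hx.1, hc.trans_lt hx.2⟩

theorem power_antitone (r h₁ h₂ : ℝ) : Antitone (power r h₁ h₂) :=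
  fun _ _ hc => measureReal_mono (rejectSet_antitone h₁ h₂ hc)

theorem bivariateNormal_real_eval {r : ℝ} (hr : |r| ≤ 1) (i : Fin 2) {A : Set ℝ}
    (hA : MeasurableSet A) :
    (bivariateNormal 1 1 r).real {x | x i ∈ A} = (gaussianReal 0 1).real A :=
  (measurePreserving_eval_bivariateNormal hr i).measureReal_preimage hA.nullMeasurableSet

theorem gaussianReal_real_band_le (h : ℝ) {c c' : ℝ} (hc : c ≤ c') :
    (gaussianReal 0 1).real {y | |h + y| ∈ Set.Icc c c'} ≤ c' - c := by
  have hsub : {y | |h + y| ∈ Set.Icc c c'} ⊆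
      Set.Icc (c - h) (c' - h) ∪ Set.Icc (-c' - h) (-c - h) := by
    rintro y ⟨h1, h2⟩
    rw [abs_le] at h2
    rcases le_abs.1 h1 with h1 | h1
    · exact Or.inl ⟨by linarith, by linarith⟩
    · exact Or.inr ⟨by linarith, by linarith⟩
  have h1 := gaussianReal_real_Icc_le (a := c - h) (b := c' - h) (by linarith)
  have h2 := gaussianReal_real_Icc_le (a := -c' - h) (b := -c - h) (by linarith)
  calc _ ≤ _ := (measureReal_mono hsub).trans (measureReal_union_le _ _)
    _ ≤ _ := by linarith

/-- A change of decision forces some coordinate into a band made of two intervals of length c' - c.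
As the normal density is at most 1/2, each coordinate costs at most c' - c, whatever the shifts. -/
theorem power_le_power_add {r : ℝ} (hr : |r| ≤ 1) (h₁ h₂ : ℝ) {c c' : ℝ} (hc : c ≤ c') :
    power r h₁ h₂ c ≤ power r h₁ h₂ c' + 2 * (c' - c) := by
  have hm (h : ℝ) : MeasurableSet {y : ℝ | |h + y| ∈ Set.Icc c c'} :=
    (by fun_prop : Measurable fun y : ℝ => |h + y|) measurableSet_Icc
  have hsub : rejectSet h₁ h₂ c ⊆ rejectSet h₁ h₂ c' ∪
      ({x | x 0 ∈ {y : ℝ | |h₁ + y| ∈ Set.Icc c c'}} ∪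
        {x | x 1 ∈ {y : ℝ | |h₂ + y| ∈ Set.Icc c c'}}) := by
    rintro x ⟨hx, hm⟩
    rw [lt_min_iff] at hm
    by_cases h1 : |h₁ + x 0| ≤ c'
    · exact Or.inr (Or.inl ⟨hm.1.le, h1⟩)
    by_cases h2 : |h₂ + x 1| ≤ c'
    · exact Or.inr (Or.inr ⟨hm.2.le, h2⟩)
    exact Or.inl ⟨hx, lt_min (not_le.1 h1) (not_le.1 h2)⟩
  have h1 := gaussianReal_real_band_le h₁ hc
  have h2 := gaussianReal_real_band_le h₂ hc
  rw [← bivariateNormal_real_eval hr 0 (hm h₁)] at h1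
  rw [← bivariateNormal_real_eval hr 1 (hm h₂)] at h2
  have h3 := (measureReal_mono hsub (μ := bivariateNormal 1 1 r)).trans (measureReal_union_le _ _)
  have h4 := measureReal_union_le (μ := bivariateNormal 1 1 r)
    {x | x 0 ∈ {y : ℝ | |h₁ + y| ∈ Set.Icc c c'}} {x | x 1 ∈ {y : ℝ | |h₂ + y| ∈ Set.Icc c c'}}
  unfold power
  linarith

/-- Tightness: the superlevel sets of f decrease to the empty set. -/
theorem exists_real_lt_of_antitone {α : Type*} [MeasurableSpace α] (μ : Measure α)
    [IsFiniteMeasure μ] {f : α → ℝ} (hf : Measurable f) {ε : ℝ} (hε : 0 < ε) :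
    ∃ K : ℝ, 0 < K ∧ μ.real {x | K < f x} < ε := by
  have hanti : Antitone fun n : ℕ => {x | (n : ℝ) < f x} := fun m n hmn x (hx : (n : ℝ) < f x) =>
    show (m : ℝ) < f x from (Nat.cast_le.2 hmn).trans_lt hx
  have h := tendsto_measure_iInter_atTop (μ := μ)
    (fun n : ℕ => (measurableSet_lt measurable_const hf).nullMeasurableSet) hanti
    ⟨0, measure_ne_top _ _⟩
  have hemp : ⋂ n : ℕ, {x | (n : ℝ) < f x} = ∅ := by
    ext x
    obtain ⟨n, hn⟩ := exists_nat_ge (f x)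
    simp only [Set.mem_iInter, Set.mem_ofPred_eq, Set.mem_empty_iff_false, iff_false, not_forall]
    exact ⟨n, hn.not_gt⟩
  rw [hemp, measure_empty] at h
  have h' := (ENNReal.tendsto_toReal ENNReal.zero_ne_top).comp h
  obtain ⟨n, hn, hn0⟩ := ((h'.eventually (gt_mem_nhds hε)).and (eventually_gt_atTop 0)).exists
  exact ⟨n, by exact_mod_cast hn0, hn⟩

/-- The rejection probabilities are continuous in the correlation, uniformly over the local
parameters and over critical values bounded away from zero. -/
theorem exists_forall_power_le_add {ε : ℝ} (hε : 0 < ε) :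
    ∃ δ > 0, ∀ r r' : ℝ, |r| ≤ 1 → |r'| ≤ 1 → |r - r'| < δ → ∀ h₁ h₂ c : ℝ, ε ≤ c →
      power r h₁ h₂ c ≤ power r' h₁ h₂ c + 3 * ε := by
  obtain ⟨K, hK, hKε⟩ := exists_real_lt_of_antitone stdPair
    (f := fun p => |p.1| + |p.2|) (by fun_prop) hε
  have hη : 0 < ε / K := by positivity
  -- The second bound serves the square roots: |√a - √b|² ≤ |a - b|, and |r² - r'²| ≤ 2|r - r'|. Off
  -- a tail of mass ε the coupled vectors then differ by at most ε; lowering c by ε costs another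
  -- 2ε.
  refine ⟨min (ε / K) ((ε / K) ^ 2 / 2), by positivity, ?_⟩
  intro r r' hr hr' hrr h₁ h₂ c hc
  rw [lt_min_iff] at hrr
  have hs : |√(1 - r ^ 2) - √(1 - r' ^ 2)| ≤ ε / K := by
    apply abs_le_of_sq_le_sq _ hη.le
    have e1 := Real.sq_sqrt (one_sub_sq_nonneg hr)
    have e2 := Real.sq_sqrt (one_sub_sq_nonneg hr')
    have n1 := Real.sqrt_nonneg (1 - r ^ 2)
    have n2 := Real.sqrt_nonneg (1 - r' ^ 2)
    have hd : |r ^ 2 - r' ^ 2| ≤ (ε / K) ^ 2 := by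
      rw [sq_sub_sq, abs_mul]
      have := abs_add_le r r'
      nlinarith [abs_nonneg (r - r'), abs_nonneg (r + r')]
    rw [abs_le] at hd
    rcases le_total √(1 - r ^ 2) √(1 - r' ^ 2) with h | h <;> nlinarith
  have hsub : correlate r ⁻¹' rejectSet h₁ h₂ c ⊆
      correlate r' ⁻¹' rejectSet h₁ h₂ (c - ε) ∪ {p | K < |p.1| + |p.2|} := by
    intro p hp
    by_cases hpK : K < |p.1| + |p.2|
    · exact Or.inr hpK
    left
    have hd : |correlate r p 1 - correlate r' p 1| ≤ ε := by
      have : correlate r p 1 - correlate r' p 1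
          = (r - r') * p.1 + (√(1 - r ^ 2) - √(1 - r' ^ 2)) * p.2 := by simp; ring
      rw [this]
      calc _ ≤ |r - r'| * |p.1| + |√(1 - r ^ 2) - √(1 - r' ^ 2)| * |p.2| := by
            rw [← abs_mul, ← abs_mul]; exact abs_add_le _ _
        _ ≤ ε / K * |p.1| + ε / K * |p.2| := by gcongr; exact hrr.1.le
        _ = ε / K * (|p.1| + |p.2|) := by ring
        _ ≤ ε / K * K := by gcongr; exact not_lt.1 hpK
        _ = ε := by field_simp
    rw [abs_le] at hd
    rw [Set.mem_preimage, mem_rejectSet_iff (by linarith)] at hp ⊢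
    rw [correlate_zero] at hp ⊢
    rcases hp with hp | hp
    · exact Or.inl ⟨by linarith, by linarith⟩
    · exact Or.inr ⟨by linarith, by linarith⟩
  have h1 := (measureReal_mono hsub (μ := stdPair)).trans (measureReal_union_le _ _)
  rw [← power_eq_stdPair hr, ← power_eq_stdPair hr'] at h1
  have h2 := power_le_power_add hr' h₁ h₂ (show c - ε ≤ c by linarith)
  linarith

theorem power_le_gaussianReal_tail {r : ℝ} (hr : |r| ≤ 1) (m c : ℝ) :
    power r 0 m c ≤ (gaussianReal 0 1).real {y | c < |y|} := by
  rw [← bivariateNormal_real_eval hr 0 (measurableSet_lt (by fun_prop) (by fun_prop))]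
  refine measureReal_mono fun x hx => ?_
  have := (lt_min_iff.1 hx.2).1
  rwa [zero_add] at this

/-- For nonnegative correlation, the rejection probabilities on the boundary of the null hypothesis
are dominated by the one-sided tail probability. -/
theorem power_le_gaussianReal_Iio {r m c : ℝ} (hr : |r| ≤ 1) (hr₀ : 0 ≤ r)
    (hc : 0 ≤ c) : power r 0 m c ≤ (gaussianReal 0 1).real (Set.Iio (-c)) := by
  set s := √(1 - r ^ 2)
  let A₁ : Set (ℝ × ℝ) := {p | c < p.1 ∧ r * p.1 + s * p.2 < -c - m}
  let A₂ : Set (ℝ × ℝ) := {p | p.1 < -c ∧ c - m < r * p.1 + s * p.2}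
  let B : Set (ℝ × ℝ) := {p | p.1 < -c}
  have hA₁ : MeasurableSet A₁ := by
    simp only [A₁, Set.ofPred_and]
    exact (measurableSet_lt (by fun_prop) (by fun_prop)).inter
      (measurableSet_lt (by fun_prop) (by fun_prop))
  have hA₂ : MeasurableSet A₂ := by
    simp only [A₂, Set.ofPred_and]
    exact (measurableSet_lt (by fun_prop) (by fun_prop)).inter
      (measurableSet_lt (by fun_prop) (by fun_prop))
  have hsub : correlate r ⁻¹' rejectSet 0 m c ⊆ A₁ ∪ A₂ := by
    intro p hp
    rw [Set.mem_preimage, mem_rejectSet_iff hc] at hp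
    simp only [correlate_zero, correlate_one, zero_add] at hp
    rcases hp with hp | hp
    · exact Or.inl ⟨hp.1, by linarith⟩
    · exact Or.inr ⟨hp.1, by linarith⟩
  have hflip : MeasurePreserving (fun p : ℝ × ℝ => (-p.1, p.2)) stdPair stdPair := by
    refine MeasurePreserving.prod ⟨by fun_prop, ?_⟩ (MeasurePreserving.id _)
    rw [gaussianReal_map_neg, neg_zero]
  -- Flipping only the first independent normal makes the two quadrants disjoint inside one tail: a
  -- common point would satisfy c < r * p.1, impossible for r ≥ 0 and p.1 < -c ≤ 0.
  have hA₁B : (fun p : ℝ × ℝ => (-p.1, p.2)) ⁻¹' A₁ ⊆ B \ A₂ := by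
    rintro p ⟨h1, h2⟩
    simp only at h1 h2
    have h3 : p.1 < -c := by linarith
    refine ⟨h3, fun h4 => ?_⟩
    have := h4.2
    nlinarith
  have hA₂B : A₂ ⊆ B := fun p hp => hp.1
  have hB : stdPair.real B = (gaussianReal 0 1).real (Set.Iio (-c)) :=
    (measurePreserving_fst (μ := gaussianReal 0 1) (ν := gaussianReal 0 1)).measureReal_preimage
      measurableSet_Iio.nullMeasurableSet
  rw [power_eq_stdPair hr, ← hB]
  calc _ ≤ stdPair.real A₁ + stdPair.real A₂ :=
        (measureReal_mono hsub).trans (measureReal_union_le _ _)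
    _ ≤ stdPair.real (B \ A₂) + stdPair.real A₂ := by
        rw [← hflip.measureReal_preimage hA₁.nullMeasurableSet]
        exact add_le_add_left (measureReal_mono hA₁B) _
    _ = stdPair.real B := by rw [measureReal_sdiff hA₂B hA₂]; ring

/-- The maximal rejection probability over the boundary of the null hypothesis. -/
noncomputable def maxPower (r c : ℝ) : ℝ := ⨆ m : Set.Ici (0 : ℝ), power r 0 m c

theorem bddAbove_power (r c : ℝ) :
    BddAbove (Set.range fun m : Set.Ici (0 : ℝ) => power r 0 m c) :=
  ⟨1, by rintro _ ⟨m, rfl⟩; exact power_le_one _ _ _ _⟩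

theorem power_le_maxPower (r c : ℝ) {m : ℝ} (hm : 0 ≤ m) : power r 0 m c ≤ maxPower r c :=
  le_ciSup (bddAbove_power r c) ⟨m, hm⟩

theorem maxPower_le {r c a : ℝ} (h : ∀ m, 0 ≤ m → power r 0 m c ≤ a) : maxPower r c ≤ a :=
  ciSup_le fun m => h m m.2

theorem exists_lt_power {r c a : ℝ} (h : a < maxPower r c) : ∃ m, 0 ≤ m ∧ a < power r 0 m c := by
  obtain ⟨m, hm⟩ := exists_lt_of_lt_ciSup h
  exact ⟨m, m.2, hm⟩

theorem maxPower_nonneg (r c : ℝ) : 0 ≤ maxPower r c :=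
  (power_nonneg _ _ _ _).trans (power_le_maxPower r c le_rfl)

theorem isCriticalValue_iff {α r c : ℝ} (hα : 0 ≤ α) :
    IsCriticalValue α r c ↔ maxPower r c = α := by
  have hset (m : ℝ) : {x : EuclideanSpace ℝ (Fin 2) | x 0 * (m + x 1) < 0 ∧
      c < min |x 0| |m + x 1|} = rejectSet 0 m c := by
    ext x; simp [rejectSet]
  have hsup : (⨆ (m : ℝ) (_ : 0 ≤ m), bivariateNormal 1 1 r (rejectSet 0 m c))
      = ENNReal.ofReal (maxPower r c) := by
    apply le_antisymm
    · refine iSup₂_le fun m hm => ?_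
      rw [← ofReal_measureReal]
      exact ENNReal.ofReal_le_ofReal (power_le_maxPower r c hm)
    · have htop : (⨆ (m : ℝ) (_ : 0 ≤ m), bivariateNormal 1 1 r (rejectSet 0 m c)) ≠ ⊤ :=
        ((iSup₂_le fun m _ => prob_le_one).trans_lt ENNReal.one_lt_top).ne
      rw [ENNReal.ofReal_le_iff_le_toReal htop]
      refine maxPower_le fun m hm => ENNReal.toReal_mono htop ?_
      exact le_iSup₂ (f := fun (m : ℝ) (_ : 0 ≤ m) => bivariateNormal 1 1 r (rejectSet 0 m c)) m hm
  simp_rw [IsCriticalValue, hset, hsup]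
  exact ENNReal.ofReal_eq_ofReal_iff (maxPower_nonneg r c) hα

theorem maxPower_antitone (r : ℝ) : Antitone (maxPower r) := fun _ _ hc =>
  maxPower_le fun _ hm => (power_antitone r 0 _ hc).trans (power_le_maxPower r _ hm)

theorem maxPower_le_maxPower_add {r : ℝ} (hr : |r| ≤ 1) {c c' : ℝ} (hc : c ≤ c') :
    maxPower r c ≤ maxPower r c' + 2 * (c' - c) :=
  maxPower_le fun _ hm => (power_le_power_add hr 0 _ hc).trans
    (by gcongr; exact power_le_maxPower r _ hm)

theorem continuous_maxPower {r : ℝ} (hr : |r| ≤ 1) : Continuous (maxPower r) := by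
  refine (LipschitzWith.of_le_add_mul 2 fun c c' => ?_).continuous
  rw [Real.dist_eq]
  rcases le_total c c' with h | h
  · have := maxPower_le_maxPower_add hr h
    have h2 := neg_le_abs (c - c')
    push_cast
    linarith
  · have := maxPower_antitone r h
    have h2 := abs_nonneg (c - c')
    push_cast
    linarith

/-- As m → ∞ the condition on the second coordinate becomes vacuous, leaving the one-sided tail of
the first. -/
theorem gaussianReal_Iio_le_maxPower {r c : ℝ} (hr : |r| ≤ 1) (hc : 0 ≤ c) :
    (gaussianReal 0 1).real (Set.Iio (-c)) ≤ maxPower r c := by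
  let A : ℕ → Set (EuclideanSpace ℝ (Fin 2)) := fun n => {x | x 0 < -c ∧ c < n + x 1}
  have hmono : Monotone A := fun m n hmn x hx =>
    ⟨hx.1, hx.2.trans_le (by have : (m : ℝ) ≤ n := Nat.cast_le.2 hmn
                             linarith)⟩
  have hun : ⋃ n, A n = {x | x 0 ∈ Set.Iio (-c)} := by
    ext x
    simp only [A, Set.mem_iUnion, Set.mem_ofPred_eq, Set.mem_Iio, exists_and_left,
      and_iff_left_iff_imp]
    intro _
    obtain ⟨n, hn⟩ := exists_nat_gt (c - x 1)
    exact ⟨n, by linarith⟩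
  have h := tendsto_measure_iUnion_atTop (μ := bivariateNormal 1 1 r) hmono
  rw [hun] at h
  have h' := (ENNReal.tendsto_toReal (measure_ne_top _ _)).comp h
  rw [← bivariateNormal_real_eval hr 0 measurableSet_Iio]
  refine le_of_tendsto' h' fun n => ?_
  refine (measureReal_mono (s₂ := rejectSet 0 n c) fun x hx => ?_).trans
    (power_le_maxPower r c (Nat.cast_nonneg n))
  rw [mem_rejectSet_iff hc]
  exact Or.inr ⟨by simpa using hx.1, hx.2⟩

theorem maxPower_eq_of_nonneg {r c : ℝ} (hr : |r| ≤ 1) (hr₀ : 0 ≤ r) (hc : 0 ≤ c) :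
    maxPower r c = (gaussianReal 0 1).real (Set.Iio (-c)) :=
  le_antisymm (maxPower_le fun _ _ => power_le_gaussianReal_Iio hr hr₀ hc)
    (gaussianReal_Iio_le_maxPower hr hc)

theorem strictMono_gaussianReal_Iio :
    StrictMono fun x => (gaussianReal 0 1).real (Set.Iio x) := by
  intro a b hab
  have h := measureReal_sdiff (μ := gaussianReal 0 1) (Set.Iio_subset_Iio hab.le) measurableSet_Iio
  have hpos : 0 < (gaussianReal 0 1).real (Set.Iio b \ Set.Iio a) := by
    refine lt_of_lt_of_le (b := (gaussianReal 0 1).real (Set.Ioo a b)) ?_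
      (measureReal_mono fun x hx => ⟨hx.2, not_lt.2 hx.1.le⟩)
    rw [measureReal_def]
    exact ENNReal.toReal_pos (isOpen_Ioo.measure_pos _ (Set.nonempty_Ioo.2 hab)).ne'
      (measure_ne_top _ _)
  simp only
  linarith

theorem maxPower_strictAntiOn {r : ℝ} (hr : |r| ≤ 1) :
    StrictAntiOn (maxPower r) (Set.Ici 0) := by
  intro c hc c' hc' hcc
  rw [Set.mem_Ici] at hc hc'
  rcases le_or_gt 0 r with hr₀ | hr₀
  · rw [maxPower_eq_of_nonneg hr hr₀ hc, maxPower_eq_of_nonneg hr hr₀ hc']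
    exact strictMono_gaussianReal_Iio (neg_lt_neg hcc)
  set s := √(1 - r ^ 2) with hs
  -- A box independent of m on which only the smaller critical value rejects, so the strict gap
  -- survives the supremum. At r = -1 one has s = 0 and c / s = 0; there the second coordinate is
  -- -p.1 and the bound on p.2 plays no role.
  let U : Set (ℝ × ℝ) := Set.Ioo (-c') (-c) ×ˢ Set.Ioi (c / s)
  have hU : IsOpen U := isOpen_Ioo.prod isOpen_Ioi
  have hUpos : 0 < stdPair.real U := by
    rw [measureReal_def]
    exact ENNReal.toReal_pos (hU.measure_pos _ ((Set.nonempty_Ioo.2 (neg_lt_neg hcc)).prod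
      Set.nonempty_Ioi)).ne' (measure_ne_top _ _)
  suffices h : ∀ m, 0 ≤ m → power r 0 m c' + stdPair.real U ≤ power r 0 m c by
    have : maxPower r c' ≤ maxPower r c - stdPair.real U := maxPower_le fun m hm => by
      have h1 := h m hm
      have h2 := power_le_maxPower r c hm
      linarith
    linarith
  intro m hm
  rw [power_eq_stdPair hr, power_eq_stdPair hr, ← measureReal_union _ hU.measurableSet]
  · refine measureReal_mono (Set.union_subset
      (Set.preimage_mono (rejectSet_antitone 0 m hcc.le)) ?_)
    rintro p ⟨⟨h1, h2⟩, h3⟩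
    rw [Set.mem_preimage, mem_rejectSet_iff hc]
    refine Or.inr ⟨by simpa using h2, ?_⟩
    rw [correlate_one, ← hs]
    have hrp : 0 < r * p.1 := mul_pos_of_neg_of_neg hr₀ (by linarith)
    rcases (Real.sqrt_nonneg (1 - r ^ 2)).lt_or_eq with h0 | h0
    · rw [← hs] at h0
      have : c < s * p.2 := by
        rw [mul_comm]
        exact (div_lt_iff₀ h0).1 h3
      linarith
    · rw [← hs] at h0
      have hr1 : r = -1 := by
        have := Real.sq_sqrt (one_sub_sq_nonneg hr)
        rw [← hs, ← h0] at this
        nlinarith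
      rw [← h0, hr1]
      linarith
  · rw [Set.disjoint_left]
    rintro p hp ⟨⟨h1, h2⟩, _⟩
    have := (lt_min_iff.1 hp.2).1
    rw [correlate_zero, zero_add, abs_of_nonpos (by linarith)] at this
    linarith

theorem exists_forall_maxPower_le_add {ε : ℝ} (hε : 0 < ε) :
    ∃ δ > 0, ∀ r r' : ℝ, |r| ≤ 1 → |r'| ≤ 1 → |r - r'| < δ → ∀ c : ℝ, ε ≤ c →
      maxPower r c ≤ maxPower r' c + 3 * ε := by
  obtain ⟨δ, hδ, h⟩ := exists_forall_power_le_add hε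
  exact ⟨δ, hδ, fun r r' hr hr' hrr c hc => maxPower_le fun m hm =>
    (h r r' hr hr' hrr 0 m c hc).trans (by gcongr; exact power_le_maxPower r' c hm)⟩

end Power

/-! ### The worst case of the null hypothesis lies on its boundary. -/

section LeastFavorable

theorem stdPair_eq_withDensity :
    stdPair = (volume : Measure (ℝ × ℝ)).withDensity
      (fun p => gaussianPDF 0 1 p.1 * gaussianPDF 0 1 p.2) := by
  rw [stdPair, gaussianReal_of_var_ne_zero _ one_ne_zero,
    prod_withDensity (measurable_gaussianPDF _ _) (measurable_gaussianPDF _ _)]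
  rfl

theorem gaussianPDF_mul_le_of_norm_le {p q : ℝ × ℝ} (h : q.1 ^ 2 + q.2 ^ 2 ≤ p.1 ^ 2 + p.2 ^ 2) :
    gaussianPDF 0 1 p.1 * gaussianPDF 0 1 p.2 ≤ gaussianPDF 0 1 q.1 * gaussianPDF 0 1 q.2 := by
  have hE (x y : ℝ) : gaussianPDF 0 1 x * gaussianPDF 0 1 y
      = ENNReal.ofReal ((√(2 * Real.pi))⁻¹ ^ 2 * Real.exp (-(x ^ 2 + y ^ 2) / 2)) := by
    rw [gaussianPDF, gaussianPDF, ← ENNReal.ofReal_mul (gaussianPDFReal_nonneg _ _ _)]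
    congr 1
    simp only [gaussianPDFReal, sub_zero, NNReal.coe_one, mul_one]
    rw [show -(x ^ 2 + y ^ 2) / 2 = -x ^ 2 / 2 + -y ^ 2 / 2 by ring, Real.exp_add]
    ring
  rw [hE, hE]
  apply ENNReal.ofReal_le_ofReal
  gcongr

/-- A volume preserving map that decreases the norm on a set increases its Gaussian measure. -/
theorem stdPair_le_of_measurePreserving {T : ℝ × ℝ → ℝ × ℝ} (hT : MeasurePreserving T)
    {A B : Set (ℝ × ℝ)} (hA : MeasurableSet A) (hB : MeasurableSet B) (hAB : A ⊆ T ⁻¹' B)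
    (hle : ∀ p ∈ A, (T p).1 ^ 2 + (T p).2 ^ 2 ≤ p.1 ^ 2 + p.2 ^ 2) :
    stdPair A ≤ stdPair B := by
  have hm : Measurable fun p : ℝ × ℝ => gaussianPDF 0 1 p.1 * gaussianPDF 0 1 p.2 :=
    ((measurable_gaussianPDF 0 1).comp measurable_fst).mul
      ((measurable_gaussianPDF 0 1).comp measurable_snd)
  rw [stdPair_eq_withDensity, withDensity_apply _ hA, withDensity_apply _ hB]
  calc _ ≤ ∫⁻ p in A, gaussianPDF 0 1 (T p).1 * gaussianPDF 0 1 (T p).2 :=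
        setLIntegral_mono (hm.comp hT.measurable)
          fun p hp => gaussianPDF_mul_le_of_norm_le (hle p hp)
    _ ≤ ∫⁻ p in T ⁻¹' B, gaussianPDF 0 1 (T p).1 * gaussianPDF 0 1 (T p).2 :=
        lintegral_mono_set hAB
    _ = _ := hT.setLIntegral_comp_preimage hB hm

/-- The probability lost in one rejection quadrant when `h₁` decreases to zero is at most the
probability gained in the opposite one. -/
theorem stdPair_strip_le {r h₁ h₂ c s : ℝ} (hs : 0 < s) (hrs : s ^ 2 = 1 - r ^ 2)
    (h12 : h₁ ≤ h₂) (hc : 0 ≤ c) :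
    stdPair {p | p.1 ∈ Set.Ioo (c - h₁) c ∧ r * p.1 + s * p.2 < -c - h₂} ≤
      stdPair {p | p.1 ∈ Set.Ioo (-c - h₁) (-c) ∧ c - h₂ < r * p.1 + s * p.2} := by
  -- With y = r * p.1 + s * p.2, this map is p.1 ↦ p.1 - 2c and h₂ + y ↦ -(h₂ + y): a translation in
  -- one correlated coordinate and a reflection in the other.
  let T : ℝ × ℝ → ℝ × ℝ := fun p => (p.1 - 2 * c, -p.2 + (2 * r * (c - p.1) - 2 * h₂) / s)
  have hT : MeasurePreserving T := by
    apply MeasurePreserving.skew_product (measurePreserving_sub_right volume (2 * c))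
      (g := fun x z => -z + (2 * r * (c - x) - 2 * h₂) / s) (by fun_prop)
    refine Eventually.of_forall fun x => ?_
    exact ((measurePreserving_add_right volume _).comp
      (Measure.measurePreserving_neg (volume : Measure ℝ))).map_eq
  have hsT (p : ℝ × ℝ) : s * (T p).2 = -(s * p.2) + 2 * r * (c - p.1) - 2 * h₂ := by
    simp only [T]; field_simp; ring
  refine stdPair_le_of_measurePreserving hT ?_ ?_ ?_ ?_
  · rw [Set.ofPred_and]
    exact (measurable_fst measurableSet_Ioo).inter (measurableSet_lt (by fun_prop) (by fun_prop))
  · rw [Set.ofPred_and]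
    exact (measurable_fst measurableSet_Ioo).inter (measurableSet_lt (by fun_prop) (by fun_prop))
  · rintro p ⟨⟨h1, h2⟩, h3⟩
    refine ⟨⟨?_, ?_⟩, ?_⟩
    · simp only [T]; linarith
    · simp only [T]; linarith
    · rw [hsT]; simp only [T]; linarith
  · rintro p ⟨⟨h1, h2⟩, h3⟩
    have hr : |r| ≤ 1 := by
      rw [← sq_le_one_iff_abs_le_one]; nlinarith
    rw [abs_le] at hr
    set t := c - p.1 with ht
    set v := -(r * p.1 + s * p.2) - h₂ with hv
    have ht0 : 0 ≤ t := by linarith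
    have hth : t ≤ h₂ := by linarith
    have hvc : c ≤ v := by linarith
    have k1 : 0 ≤ h₂ - r * t := by nlinarith
    have k2 : 0 ≤ (v - c) * (h₂ - r * t) := mul_nonneg (by linarith) k1
    have k3 : 0 ≤ c * ((1 + r) * (h₂ - t)) :=
      mul_nonneg hc (mul_nonneg (by linarith) (by linarith))
    have e1 : (T p).1 = -c - t := by simp only [T]; linarith
    have e2 : s * (T p).2 = v - h₂ + r * (c + t) := by rw [hsT]; simp only [hv, ht]; ring
    have e3 : p.1 = c - t := by linarith
    have e4 : s * p.2 = -(v + h₂) - r * (c - t) := by rw [hv, e3]; ring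
    -- The right side minus the left is exactly four times the sum of the quantities in `k2` and
    -- `k3`.
    have hkey : s ^ 2 * ((T p).1 ^ 2 + (T p).2 ^ 2) ≤ s ^ 2 * (p.1 ^ 2 + p.2 ^ 2) := by
      have a1 : s ^ 2 * ((T p).1 ^ 2 + (T p).2 ^ 2)
          = (1 - r ^ 2) * (T p).1 ^ 2 + (s * (T p).2) ^ 2 := by rw [← hrs]; ring
      have a2 : s ^ 2 * (p.1 ^ 2 + p.2 ^ 2)
          = (1 - r ^ 2) * p.1 ^ 2 + (s * p.2) ^ 2 := by rw [← hrs]; ring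
      rw [a1, a2, e1, e2, e3, e4]
      nlinarith
    exact le_of_mul_le_mul_left hkey (by positivity)

theorem power_le_power_zero {r h₁ h₂ c : ℝ} (hr : |r| ≤ 1) (h₁0 : 0 ≤ h₁) (h12 : h₁ ≤ h₂)
    (hc : 0 ≤ c) : power r h₁ h₂ c ≤ power r 0 h₂ c := by
  rw [power_eq_stdPair hr, power_eq_stdPair hr]
  set s := √(1 - r ^ 2) with hs
  have hs2 : s ^ 2 = 1 - r ^ 2 := Real.sq_sqrt (one_sub_sq_nonneg hr)
  rcases (Real.sqrt_nonneg (1 - r ^ 2)).lt_or_eq with h0 | h0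
  · rw [← hs] at h0
    let A : Set (ℝ × ℝ) := {p | c < p.1 ∧ r * p.1 + s * p.2 < -c - h₂}
    let B : Set (ℝ × ℝ) := {p | p.1 < -c - h₁ ∧ c - h₂ < r * p.1 + s * p.2}
    let D₁ : Set (ℝ × ℝ) := {p | p.1 ∈ Set.Ioo (c - h₁) c ∧ r * p.1 + s * p.2 < -c - h₂}
    let D₂ : Set (ℝ × ℝ) := {p | p.1 ∈ Set.Ioo (-c - h₁) (-c) ∧ c - h₂ < r * p.1 + s * p.2}
    have hB : MeasurableSet B := by
      simp only [B, Set.ofPred_and]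
      exact (measurableSet_lt (by fun_prop) (by fun_prop)).inter
        (measurableSet_lt (by fun_prop) (by fun_prop))
    have hD₂ : MeasurableSet D₂ := by
      simp only [D₂, Set.ofPred_and]
      exact (measurable_fst measurableSet_Ioo).inter (measurableSet_lt (by fun_prop) (by fun_prop))
    have hAB : Disjoint A B := Set.disjoint_left.2 fun p hA hB => by
      have h1 := hA.1
      have h2 := hB.1
      linarith
    have hABD : Disjoint (A ∪ B) D₂ := Set.disjoint_left.2 fun p hAB hD => by
      have h1 := hD.1.1
      have h2 := hD.1.2
      rcases hAB with hA | hB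
      · have h3 := hA.1
        linarith
      · have h3 := hB.1
        linarith
    -- The line p.1 = c lies in neither `A` nor the open strip `D₁`.
    have hnull : stdPair.real {p | p.1 ∈ Set.Icc c c} ≤ 0 := by
      have h1 := gaussianReal_real_Icc_le (le_refl c)
      rw [← (measurePreserving_fst (μ := gaussianReal 0 1)
        (ν := gaussianReal 0 1)).measureReal_preimage measurableSet_Icc.nullMeasurableSet] at h1
      rw [sub_self, zero_div] at h1
      exact h1
    have hsub : correlate r ⁻¹' rejectSet h₁ h₂ c ⊆ A ∪ B ∪ D₁ ∪ {p | p.1 ∈ Set.Icc c c} := by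
      intro p hp
      rw [Set.mem_preimage, mem_rejectSet_iff hc, correlate_zero, correlate_one, ← hs] at hp
      rcases hp with ⟨h1, h2⟩ | ⟨h1, h2⟩
      · rcases lt_trichotomy c p.1 with h | h | h
        · exact Or.inl (Or.inl (Or.inl ⟨h, by linarith⟩))
        · exact Or.inr ⟨h.le, h.ge⟩
        · exact Or.inl (Or.inr ⟨⟨by linarith, h⟩, by linarith⟩)
      · exact Or.inl (Or.inl (Or.inr ⟨by linarith, by linarith⟩))
    have hsup : A ∪ B ∪ D₂ ⊆ correlate r ⁻¹' rejectSet 0 h₂ c := by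
      intro p hp
      rw [Set.mem_preimage, mem_rejectSet_iff hc, correlate_zero, correlate_one, ← hs]
      rcases hp with (⟨h1, h2⟩ | ⟨h1, h2⟩) | ⟨⟨h1, h2⟩, h3⟩
      · exact Or.inl ⟨by linarith, by linarith⟩
      · exact Or.inr ⟨by linarith, by linarith⟩
      · exact Or.inr ⟨by linarith, by linarith⟩
    have hD : stdPair.real D₁ ≤ stdPair.real D₂ :=
      ENNReal.toReal_mono (measure_ne_top _ _) (stdPair_strip_le h0 hs2 h12 hc)
    calc _ ≤ stdPair.real (A ∪ B ∪ D₁) + stdPair.real {p | p.1 ∈ Set.Icc c c} :=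
          (measureReal_mono hsub).trans (measureReal_union_le _ _)
      _ ≤ stdPair.real (A ∪ B) + stdPair.real D₁ + 0 :=
          add_le_add (measureReal_union_le _ _) hnull
      _ ≤ stdPair.real (A ∪ B) + stdPair.real D₂ := by linarith
      _ = stdPair.real (A ∪ B ∪ D₂) := (measureReal_union hABD hD₂).symm
      _ ≤ _ := measureReal_mono hsup
  -- For r = ±1 the map is unavailable, but the rejection sets are nested: at r = 1 the first
  -- quadrant is empty since h₁ ≤ h₂, and at r = -1 its second inequality gives p.1 > c + h₂ ≥ c.
  · rw [← hs] at h0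
    have hr1 : r = 1 ∨ r = -1 := by
      rw [← h0] at hs2
      exact mul_self_eq_one_iff.1 (by linarith)
    refine measureReal_mono fun p hp => ?_
    rw [Set.mem_preimage, mem_rejectSet_iff hc, correlate_zero, correlate_one, ← hs, ← h0] at hp ⊢
    rcases hr1 with rfl | rfl
    · rcases hp with hp | hp
      · exfalso; linarith
      · exact Or.inr ⟨by linarith, by linarith⟩
    · rcases hp with hp | hp
      · exact Or.inl ⟨by linarith, by linarith⟩
      · exact Or.inr ⟨by linarith, by linarith⟩

/-- The rejection probability under the null hypothesis is largest on its boundary. -/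
theorem power_le_maxPower_of_mul_nonneg {r h₁ h₂ c : ℝ} (hr : |r| ≤ 1) (hh : 0 ≤ h₁ * h₂)
    (hc : 0 ≤ c) : power r h₁ h₂ c ≤ maxPower r c := by
  have key : ∀ a b : ℝ, 0 ≤ a → 0 ≤ b → power r a b c ≤ maxPower r c := by
    intro a b ha hb
    rcases le_total a b with h | h
    · exact (power_le_power_zero hr ha h hc).trans (power_le_maxPower r c hb)
    · rw [power_swap hr]
      exact (power_le_power_zero hr hb h hc).trans (power_le_maxPower r c ha)
  rcases mul_nonneg_iff.1 hh with ⟨h1, h2⟩ | ⟨h1, h2⟩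
  · exact key _ _ h1 h2
  · rw [← power_neg hr]
    exact key _ _ (by linarith) (by linarith)

end LeastFavorable

/-! ### Existence, uniqueness and continuity of the critical value. -/

section CriticalValue

theorem gaussianReal_real_Iio_neg (x : ℝ) :
    (gaussianReal 0 1).real (Set.Iio (-x)) = 1 - cdf (gaussianReal 0 1) x := by
  have hflip : MeasurePreserving (fun y : ℝ => -y) (gaussianReal 0 1) (gaussianReal 0 1) :=
    ⟨by fun_prop, by rw [gaussianReal_map_neg, neg_zero]⟩
  have hpre : (fun y : ℝ => -y) ⁻¹' Set.Iio (-x) = (Set.Iic x)ᶜ := by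
    ext y; simp
  rw [← hflip.measureReal_preimage measurableSet_Iio.nullMeasurableSet, hpre,
    probReal_compl_eq_one_sub measurableSet_Iic, cdf_eq_real]

theorem continuous_gaussianReal_Iio :
    Continuous fun x => (gaussianReal 0 1).real (Set.Iio x) := by
  refine (LipschitzWith.of_le_add fun a b => ?_).continuous
  rw [Real.dist_eq]
  rcases le_total a b with h | h
  · have := measureReal_mono (μ := gaussianReal 0 1) (Set.Iio_subset_Iio h)
    have := abs_nonneg (a - b)
    linarith
  · have hsub : Set.Iio a ⊆ Set.Iio b ∪ Set.Icc b a := fun y hy => by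
      rcases lt_or_ge y b with hb | hb
      · exact Or.inl hb
      · exact Or.inr ⟨hb, (Set.mem_Iio.1 hy).le⟩
    have h1 := (measureReal_mono (μ := gaussianReal 0 1) hsub).trans (measureReal_union_le _ _)
    have h2 := gaussianReal_real_Icc_le h
    have h3 := le_abs_self (a - b)
    linarith

theorem gaussianReal_real_Iio_zero : (gaussianReal 0 1).real (Set.Iio 0) = 1 / 2 := by
  have h := gaussianReal_real_Iio_neg 0
  rw [neg_zero, cdf_eq_real, ← Set.Iio_union_right, measureReal_union (by simp) (by simp)] at h
  have h0 : (gaussianReal 0 1).real {0} = 0 := by simp [measureReal_def]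
  linarith

/-- The standard normal quantile at level `1 - α` has upper tail probability `α`. -/
theorem gaussianReal_Iio_neg_quantile {α : ℝ} (hα₀ : 0 < α) (hα₁ : α < 1 / 2) :
    0 < stdNormalQuantile (1 - α) ∧
      (gaussianReal 0 1).real (Set.Iio (-stdNormalQuantile (1 - α))) = α := by
  obtain ⟨K, hK, hKα⟩ := exists_real_lt_of_antitone (gaussianReal 0 1) (f := fun y => |y|)
    (by fun_prop) hα₀
  have hKI : (gaussianReal 0 1).real (Set.Iio (-K)) ≤ α :=
    (measureReal_mono fun y (hy : y < -K) =>
      show K < |y| from lt_abs.2 (Or.inr (lt_neg_of_lt_neg hy))).trans hKα.le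
  obtain ⟨y, hy, hyα⟩ := intermediate_value_Icc (by linarith : -K ≤ 0)
    continuous_gaussianReal_Iio.continuousOn
    (show α ∈ Set.Icc _ _ from ⟨hKI, by simp only [gaussianReal_real_Iio_zero]; linarith⟩)
  simp only at hyα
  have hset : {x : ℝ | 1 - α ≤ cdf (gaussianReal 0 1) x} = Set.Ici (-y) := by
    ext x
    have h1 := gaussianReal_real_Iio_neg x
    rw [Set.mem_ofPred_eq, Set.mem_Ici, neg_le, ← strictMono_gaussianReal_Iio.le_iff_le (a := -x), hyα, h1]
    constructor <;> intro h <;> linarith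
  have hq : stdNormalQuantile (1 - α) = -y := by rw [stdNormalQuantile, hset, csInf_Ici]
  rw [hq, neg_neg]
  refine ⟨?_, hyα⟩
  have : y ≠ 0 := by
    rintro rfl
    rw [gaussianReal_real_Iio_zero] at hyα
    linarith
  have := lt_of_le_of_ne hy.2 this
  linarith

/-- For c ≤ 0 the maximal power is at least 1/2. This confines solutions to the range where strict
monotonicity is known. -/
theorem pos_of_maxPower_eq {α r c : ℝ} (hr : |r| ≤ 1) (hα₁ : α < 1 / 2) (hc : maxPower r c = α) :
    0 < c := by
  by_contra! h
  have h1 := maxPower_antitone r h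
  have h2 := gaussianReal_Iio_le_maxPower hr le_rfl
  rw [neg_zero, gaussianReal_real_Iio_zero] at h2
  linarith

theorem existsUnique_maxPower_eq {α r : ℝ} (hr : |r| ≤ 1) (hα₀ : 0 < α) (hα₁ : α < 1 / 2) :
    ∃! c, maxPower r c = α := by
  obtain ⟨K, hK, hKα⟩ := exists_real_lt_of_antitone (gaussianReal 0 1) (f := fun y => |y|)
    (by fun_prop) hα₀
  have h0 := gaussianReal_Iio_le_maxPower hr le_rfl
  rw [neg_zero, gaussianReal_real_Iio_zero] at h0
  obtain ⟨c, hc, hcα⟩ := intermediate_value_Icc' hK.le (continuous_maxPower hr).continuousOn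
    (show α ∈ Set.Icc _ _ from
      ⟨maxPower_le fun m _ => (power_le_gaussianReal_tail hr m K).trans hKα.le, by linarith⟩)
  refine ⟨c, hcα, fun c' hc' => ?_⟩
  exact (maxPower_strictAntiOn hr).injOn (pos_of_maxPower_eq hr hα₁ hc').le hc.1
    (hc'.trans hcα.symm)

/-- The critical value as a function of the correlation. -/
noncomputable def criticalValue (α r : ℝ) : ℝ := Classical.epsilon fun c => maxPower r c = α

theorem maxPower_criticalValue {α r : ℝ} (hr : |r| ≤ 1) (hα₀ : 0 < α) (hα₁ : α < 1 / 2) :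
    maxPower r (criticalValue α r) = α :=
  Classical.epsilon_spec (existsUnique_maxPower_eq hr hα₀ hα₁).exists

theorem continuousOn_criticalValue {α : ℝ} (hα₀ : 0 < α) (hα₁ : α < 1 / 2) :
    ContinuousOn (criticalValue α) (Set.Icc (-1) 1) := by
  rw [Metric.continuousOn_iff]
  intro r hr ε hε
  rw [Set.mem_Icc, ← abs_le] at hr
  have hκ := maxPower_criticalValue hr hα₀ hα₁
  set κ := criticalValue α r with hκdef
  have hκ0 := pos_of_maxPower_eq hr hα₁ hκ
  set η := min (ε / 2) (κ / 2) with hη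
  have hη0 : 0 < η := by positivity
  have hηε : η < ε := (min_le_left _ _).trans_lt (by linarith)
  have hηκ : η ≤ κ / 2 := min_le_right _ _
  have hlo : α < maxPower r (κ - η) := hκ ▸ maxPower_strictAntiOn hr
    (show 0 ≤ κ - η by linarith) hκ0.le (by linarith)
  have hhi : maxPower r (κ + η) < α := hκ ▸ maxPower_strictAntiOn hr
    hκ0.le (show 0 ≤ κ + η by linarith) (by linarith)
  -- The perturbation 3ζ stays below both gaps, so κ ± η still bracket level α at r'. The bound κ /
  -- 2 ensures ζ ≤ κ - η, as uniform continuity in r requires.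
  set ζ := min (κ / 2) (min ((maxPower r (κ - η) - α) / 4) ((α - maxPower r (κ + η)) / 4)) with hζ
  have hζ0 : 0 < ζ := lt_min (by positivity) (lt_min (by linarith) (by linarith))
  have hζ1 : ζ ≤ κ / 2 := min_le_left _ _
  have hζ2 : ζ ≤ (maxPower r (κ - η) - α) / 4 := (min_le_right _ _).trans (min_le_left _ _)
  have hζ3 : ζ ≤ (α - maxPower r (κ + η)) / 4 := (min_le_right _ _).trans (min_le_right _ _)
  obtain ⟨δ, hδ, h⟩ := exists_forall_maxPower_le_add hζ0
  refine ⟨δ, hδ, fun r' hr' hrr => ?_⟩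
  rw [Set.mem_Icc, ← abs_le] at hr'
  rw [Real.dist_eq] at hrr
  have hκ' := maxPower_criticalValue hr' hα₀ hα₁
  have h1 := h r r' hr hr' (abs_sub_comm r r' ▸ hrr) (κ - η) (by linarith)
  have h2 := h r' r hr' hr hrr (κ + η) (by linarith)
  have l1 : κ - η < criticalValue α r' := by
    by_contra! hle
    have := maxPower_antitone r' hle
    linarith
  have l2 : criticalValue α r' < κ + η := by
    by_contra! hle
    have := maxPower_antitone r' hle
    linarith
  rw [Real.dist_eq, abs_lt]
  constructor <;> linarith

end CriticalValue

/-! ### From distribution functions to quadrant probabilities. -/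

section Quadrants

theorem abs_measureReal_margin_sub_le {μ ν : Measure (EuclideanSpace ℝ (Fin 2))}
    [IsProbabilityMeasure μ] [IsProbabilityMeasure ν] {ε : ℝ} (i j : Fin 2)
    (h : ∀ t u : ℝ, |μ.real {x | x i ≤ t ∧ x j ≤ u} - ν.real {x | x i ≤ t ∧ x j ≤ u}| ≤ ε)
    (u : ℝ) : |μ.real {x | x j ≤ u} - ν.real {x | x j ≤ u}| ≤ ε := by
  have hlim (μ : Measure (EuclideanSpace ℝ (Fin 2))) [IsProbabilityMeasure μ] :
      Tendsto (fun n : ℕ => μ.real {x | x i ≤ n ∧ x j ≤ u}) atTop (𝓝 (μ.real {x | x j ≤ u})) := by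
    have hmono : Monotone fun n : ℕ => {x : EuclideanSpace ℝ (Fin 2) | x i ≤ n ∧ x j ≤ u} :=
      fun m n hmn x hx => ⟨hx.1.trans (Nat.cast_le.2 hmn), hx.2⟩
    have hun : ⋃ n : ℕ, {x : EuclideanSpace ℝ (Fin 2) | x i ≤ n ∧ x j ≤ u} = {x | x j ≤ u} := by
      ext x
      simp only [Set.mem_iUnion, Set.mem_ofPred_eq, exists_and_right, and_iff_right_iff_imp]
      exact fun _ => exists_nat_ge (x i)
    have h := tendsto_measure_iUnion_atTop (μ := μ) hmono
    rw [hun] at h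
    exact (ENNReal.tendsto_toReal (measure_ne_top _ _)).comp h
  exact le_of_tendsto' ((hlim μ).sub (hlim ν)).abs fun n => h n u

theorem measurableSet_orthant (i j : Fin 2) (t u : ℝ) :
    MeasurableSet {x : EuclideanSpace ℝ (Fin 2) | x i ≤ t ∧ x j ≤ u} := by
  rw [Set.ofPred_and]
  exact (measurableSet_le (by fun_prop) (by fun_prop)).inter
    (measurableSet_le (by fun_prop) (by fun_prop))

/-- Such a quadrant is a half-plane minus an orthant; each contributes one ε, the half-plane being a
limit of orthants. -/
theorem abs_measureReal_quadrant_sub_le {μ ν : Measure (EuclideanSpace ℝ (Fin 2))}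
    [IsProbabilityMeasure μ] [IsProbabilityMeasure ν] {ε : ℝ} (i j : Fin 2)
    (h : ∀ t u : ℝ, |μ.real {x | x i ≤ t ∧ x j ≤ u} - ν.real {x | x i ≤ t ∧ x j ≤ u}| ≤ ε)
    (t u : ℝ) :
    |μ.real {x | t < x i ∧ x j ≤ u} - ν.real {x | t < x i ∧ x j ≤ u}| ≤ 2 * ε := by
  have hdiff (μ : Measure (EuclideanSpace ℝ (Fin 2))) [IsProbabilityMeasure μ] :
      μ.real {x | t < x i ∧ x j ≤ u}
        = μ.real {x | x j ≤ u} - μ.real {x | x i ≤ t ∧ x j ≤ u} := by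
    have hsub : {x : EuclideanSpace ℝ (Fin 2) | x i ≤ t ∧ x j ≤ u} ⊆ {x | x j ≤ u} :=
      fun x hx => hx.2
    rw [← measureReal_sdiff hsub (measurableSet_orthant i j t u)]
    congr 1
    ext x
    simp only [Set.mem_ofPred_eq, Set.mem_sdiff, not_and, not_le]
    constructor
    · exact fun h => ⟨h.2, fun h' => absurd h' h.1.not_ge⟩
    · exact fun h => ⟨lt_of_not_ge fun h' => absurd h.1 (h.2 h').not_ge, h.1⟩
  rw [hdiff μ, hdiff ν]
  have h1 := abs_measureReal_margin_sub_le i j h u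
  have h2 := h t u
  rw [abs_le] at h1 h2 ⊢
  constructor <;> linarith

/-- The union of the two opposite half-open quadrants on which a test with critical value `c`
rejects. -/
def quadrantSet (h₁ h₂ c : ℝ) : Set (EuclideanSpace ℝ (Fin 2)) :=
  {x | c - h₁ < x 0 ∧ x 1 ≤ -c - h₂} ∪ {x | c - h₂ < x 1 ∧ x 0 ≤ -c - h₁}

theorem measurableSet_halfOpenQuadrant (i j : Fin 2) (t u : ℝ) :
    MeasurableSet {x : EuclideanSpace ℝ (Fin 2) | t < x i ∧ x j ≤ u} := by
  rw [Set.ofPred_and]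
  exact (measurableSet_lt (by fun_prop) (by fun_prop)).inter
    (measurableSet_le (by fun_prop) (by fun_prop))

theorem measurableSet_quadrantSet (h₁ h₂ c : ℝ) : MeasurableSet (quadrantSet h₁ h₂ c) :=
  (measurableSet_halfOpenQuadrant 0 1 _ _).union (measurableSet_halfOpenQuadrant 1 0 _ _)

theorem abs_measureReal_quadrantSet_sub_le {μ ν : Measure (EuclideanSpace ℝ (Fin 2))}
    [IsProbabilityMeasure μ] [IsProbabilityMeasure ν] {ε : ℝ}
    (h : ∀ t u : ℝ, |μ.real {x | x 0 ≤ t ∧ x 1 ≤ u} - ν.real {x | x 0 ≤ t ∧ x 1 ≤ u}| ≤ ε)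
    (h₁ h₂ : ℝ) {c : ℝ} (hc : 0 ≤ c) :
    |μ.real (quadrantSet h₁ h₂ c) - ν.real (quadrantSet h₁ h₂ c)| ≤ 4 * ε := by
  have h' : ∀ t u : ℝ, |μ.real {x | x 1 ≤ t ∧ x 0 ≤ u} - ν.real {x | x 1 ≤ t ∧ x 0 ≤ u}| ≤ ε :=
    fun t u => by simpa only [and_comm] using h u t
  have hdisj : Disjoint {x : EuclideanSpace ℝ (Fin 2) | c - h₁ < x 0 ∧ x 1 ≤ -c - h₂}
      {x | c - h₂ < x 1 ∧ x 0 ≤ -c - h₁} := Set.disjoint_left.2 fun x hx hy => by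
    have h1 := hx.1
    have h2 := hy.2
    linarith
  rw [quadrantSet, measureReal_union hdisj (measurableSet_halfOpenQuadrant 1 0 _ _),
    measureReal_union hdisj (measurableSet_halfOpenQuadrant 1 0 _ _)]
  have h1 := abs_measureReal_quadrant_sub_le 0 1 h (c - h₁) (-c - h₂)
  have h2 := abs_measureReal_quadrant_sub_le 1 0 h' (c - h₂) (-c - h₁)
  rw [abs_le] at h1 h2 ⊢
  constructor <;> linarith

theorem power_le_quadrantSet (r h₁ h₂ : ℝ) {c : ℝ} (hc : 0 ≤ c) :
    power r h₁ h₂ c ≤ (bivariateNormal 1 1 r).real (quadrantSet h₁ h₂ c) := by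
  refine measureReal_mono fun x hx => ?_
  rw [mem_rejectSet_iff hc] at hx
  rcases hx with ⟨h1, h2⟩ | ⟨h1, h2⟩
  · exact Or.inl ⟨by linarith, by linarith⟩
  · exact Or.inr ⟨by linarith, by linarith⟩

theorem quadrantSet_le_power (r h₁ h₂ : ℝ) {c c' : ℝ} (hc : 0 ≤ c) (hcc : c < c') :
    (bivariateNormal 1 1 r).real (quadrantSet h₁ h₂ c') ≤ power r h₁ h₂ c := by
  refine measureReal_mono fun x hx => ?_
  rw [mem_rejectSet_iff hc]
  rcases hx with ⟨h1, h2⟩ | ⟨h1, h2⟩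
  · exact Or.inl ⟨by linarith, by linarith⟩
  · exact Or.inr ⟨by linarith, by linarith⟩

end Quadrants

/-! ### Uniform approximation of the feasible test and its limiting size. -/

section Asymptotics

variable {DGP : Type*} {Ω : ℕ → Type*} [∀ n, MeasurableSpace (Ω n)]

instance (M : StatModel DGP Ω) (P : DGP) (n : ℕ) : IsProbabilityMeasure (M.law P n) :=
  M.isProbabilityMeasure_law P n

/-- The estimation error of the means, in units of the standard errors. -/
noncomputable def standardizedError (M : StatModel DGP Ω) (E : Estimators Ω) (P : DGP) (n : ℕ)
    (ω : Ω n) : EuclideanSpace ℝ (Fin 2) :=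
  !₂[√n * (E.μ₁ n ω - M.μ₁ P) / M.σ₁ P, √n * (E.μ₂ n ω - M.μ₂ P) / M.σ₂ P]

theorem measurable_standardizedError (M : StatModel DGP Ω) (E : Estimators Ω) (P : DGP) (n : ℕ) :
    Measurable (standardizedError M E P n) := by
  have h1 := E.measurable_μ₁ n
  have h2 := E.measurable_μ₂ n
  unfold standardizedError
  fun_prop

/-- Division by σ₁, σ₂ carries orthants to orthants, and uniformity over thresholds lets these
depend on P. -/
theorem UniformCLT.eventually_quadrantSet {M : StatModel DGP Ω} {E : Estimators Ω}
    (hCLT : UniformCLT M E) {ε : ℝ} (hε : 0 < ε) :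
    ∀ᶠ n : ℕ in atTop, ∀ (P : DGP) (h₁ h₂ c : ℝ), 0 ≤ c →
      |(M.law P n).real (standardizedError M E P n ⁻¹' quadrantSet h₁ h₂ c)
        - (bivariateNormal 1 1 (M.ρ P)).real (quadrantSet h₁ h₂ c)| ≤ 4 * ε := by
  filter_upwards [hCLT ε hε] with n hn P h₁ h₂ c hc
  have hW := measurable_standardizedError M E P n
  have := Measure.isProbabilityMeasure_map (μ := M.law P n) hW.aemeasurable
  have hσ₁ := M.σ₁_pos P
  have hσ₂ := M.σ₂_pos P
  rw [← map_measureReal_apply hW (measurableSet_quadrantSet _ _ _)]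
  refine abs_measureReal_quadrantSet_sub_le (fun t u => ?_) h₁ h₂ hc
  have h := hn P (M.σ₁ P * t) (M.σ₂ P * u)
  rw [← (measurePreserving_scale_bivariateNormal (M.σ₁ P) (M.σ₂ P)
    (M.abs_ρ_le_one P)).measureReal_preimage (measurableSet_orthant 0 1 _ _).nullMeasurableSet] at h
  rw [map_measureReal_apply hW (measurableSet_orthant 0 1 _ _)]
  have hpre : standardizedError M E P n ⁻¹' {x | x 0 ≤ t ∧ x 1 ≤ u}
      = {ω | √n * (E.μ₁ n ω - M.μ₁ P) ≤ M.σ₁ P * t ∧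
        √n * (E.μ₂ n ω - M.μ₂ P) ≤ M.σ₂ P * u} := by
    ext ω
    simp [standardizedError, div_le_iff₀' hσ₁, div_le_iff₀' hσ₂]
  have hscale : (fun x : EuclideanSpace ℝ (Fin 2) => !₂[M.σ₁ P * x 0, M.σ₂ P * x 1]) ⁻¹'
      {x | x 0 ≤ M.σ₁ P * t ∧ x 1 ≤ M.σ₂ P * u} = {x | x 0 ≤ t ∧ x 1 ≤ u} := by
    ext x
    simp [mul_le_mul_iff_right₀ hσ₁, mul_le_mul_iff_right₀ hσ₂]
  rw [hscale] at h
  rw [hpre]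
  exact h.le

theorem TendstoZeroInProbUniformly.eventually_lt {M : StatModel DGP Ω}
    {Y : DGP → (n : ℕ) → Ω n → ℝ} (hY : TendstoZeroInProbUniformly M Y) {δ ε : ℝ} (hδ : 0 < δ)
    (hε : 0 < ε) : ∀ᶠ n : ℕ in atTop, ∀ P, (M.law P n).real {ω | δ ≤ |Y P n ω|} ≤ ε := by
  filter_upwards [(hY δ hδ).eventually (gt_mem_nhds (ENNReal.ofReal_pos.2 hε))] with n hn P
  exact ENNReal.toReal_le_of_le_ofReal hε.le
    ((le_iSup (fun P => M.law P n {ω | δ ≤ |Y P n ω|}) P).trans hn.le)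

/-- Moves the estimation error of the standard deviation from the statistic into the critical value.
-/
theorem le_mul_abs_div_iff {k m s σ c : ℝ} (hk : 0 ≤ k) (hs : 0 < s) (hσ : 0 < σ) :
    c ≤ k * (|m| / s) ↔ c * (s / σ) ≤ |k * m / σ| := by
  rw [abs_div, abs_mul, abs_of_nonneg hk, abs_of_pos hσ, ← mul_div_assoc, ← mul_div_assoc,
    le_div_iff₀ hs, div_le_div_iff_of_pos_right hσ]

theorem abs_mul_sub_le_of_close {c κ b q η : ℝ} (hc : |c| ≤ b) (hcκ : |c - κ| ≤ η / 2) (hb : 0 < b)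
    (hq : |q - 1| ≤ η / (2 * b)) : |c * q - κ| ≤ η := by
  have h1 : c * q - κ = c * (q - 1) + (c - κ) := by ring
  calc |c * q - κ| ≤ |c| * |q - 1| + |c - κ| := by
        rw [h1, ← abs_mul]; exact abs_add_le _ _
    _ ≤ b * (η / (2 * b)) + η / 2 := by gcongr
    _ = η := by field_simp; ring

/-- Uniform approximation of the rejection probability of the feasible test, with a critical value
depending continuously on the estimated correlation, by its asymptotic counterpart. -/
theorem eventually_abs_rejection_sub_power_le {M : StatModel DGP Ω} {E : Estimators Ω}
    (hCLT : UniformCLT M E) (hcons : UniformlyConsistent M E) {κ : ℝ → ℝ}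
    (hκ : ContinuousOn κ (Set.Icc (-1) 1)) (hκ₀ : ∀ r, |r| ≤ 1 → 0 < κ r) {ε : ℝ} (hε : 0 < ε) :
    ∀ᶠ n : ℕ in atTop, ∀ P : DGP,
      |(M.law P n).real (rejectionEvent E (fun n ω => κ (E.ρ n ω)) n)
        - power (M.ρ P) (√n * M.μ₁ P / M.σ₁ P) (√n * M.μ₂ P / M.σ₂ P) (κ (M.ρ P))|
      ≤ 13 * ε := by
  have hne : (Set.Icc (-1 : ℝ) 1).Nonempty := ⟨0, by norm_num, by norm_num⟩
  obtain ⟨ra, hra, ha⟩ := isCompact_Icc.exists_isMinOn hne hκ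
  obtain ⟨rb, hrb, hb⟩ := isCompact_Icc.exists_isMaxOn hne hκ
  have ha0 := hκ₀ ra (abs_le.2 hra)
  have hb0 := hκ₀ rb (abs_le.2 hrb)
  set a := κ ra
  set b := κ rb
  set η := min ε (a / 4) with hη
  have hη0 : 0 < η := by positivity
  have hηε : η ≤ ε := min_le_left _ _
  have hηa : η ≤ a / 4 := min_le_right _ _
  obtain ⟨δ, hδ, hκδ⟩ := Metric.uniformContinuousOn_iff.1
    (isCompact_Icc.uniformContinuousOn_of_continuous hκ) (η / 2) (by positivity)
  -- The bound 1/2 forces the estimated standard deviations, not assumed positive, to be positive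
  -- off the bad event.
  set ζ := min (1 / 2) (η / (2 * b)) with hζ
  have hζ0 : 0 < ζ := by positivity
  filter_upwards [hCLT.eventually_quadrantSet hε, hcons.1.eventually_lt hζ0 hε,
    hcons.2.1.eventually_lt hζ0 hε, hcons.2.2.eventually_lt hδ hε, eventually_gt_atTop 0]
    with n hquad hσ₁ hσ₂ hρ hn P
  have hquad := hquad P (√n * M.μ₁ P / M.σ₁ P) (√n * M.μ₂ P / M.σ₂ P)
  have hσ₁ := hσ₁ P
  have hσ₂ := hσ₂ P
  have hρ := hρ P
  have hn0 : 0 < √(n : ℝ) := Real.sqrt_pos.2 (Nat.cast_pos.2 hn)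
  have s₁ := M.σ₁_pos P
  have s₂ := M.σ₂_pos P
  have hr := M.abs_ρ_le_one P
  have hκa : a ≤ κ (M.ρ P) := ha (abs_le.1 hr)
  set r := M.ρ P
  set h₁ := √(n : ℝ) * M.μ₁ P / M.σ₁ P with hh₁
  set h₂ := √(n : ℝ) * M.μ₂ P / M.σ₂ P with hh₂
  set W := standardizedError M E P n with hW
  set R := rejectionEvent E (fun n ω => κ (E.ρ n ω)) n with hR
  let B : Set (Ω n) := {ω | ζ ≤ |E.σ₁ n ω / M.σ₁ P - 1|} ∪ {ω | ζ ≤ |E.σ₂ n ω / M.σ₂ P - 1|} ∪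
    {ω | δ ≤ |E.ρ n ω - r|}
  have hB : (M.law P n).real B ≤ 3 * ε := by
    have h1 := measureReal_union_le (μ := M.law P n) ({ω | ζ ≤ |E.σ₁ n ω / M.σ₁ P - 1|} ∪
      {ω | ζ ≤ |E.σ₂ n ω / M.σ₂ P - 1|}) {ω | δ ≤ |E.ρ n ω - r|}
    have h2 := measureReal_union_le (μ := M.law P n) {ω | ζ ≤ |E.σ₁ n ω / M.σ₁ P - 1|}
      {ω | ζ ≤ |E.σ₂ n ω / M.σ₂ P - 1|}
    simp only [B]
    linarith
  have hW0 (ω : Ω n) : W ω 0 = √(n : ℝ) * E.μ₁ n ω / M.σ₁ P - h₁ := by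
    change √(n : ℝ) * (E.μ₁ n ω - M.μ₁ P) / M.σ₁ P = _
    rw [hh₁]
    ring
  have hW1 (ω : Ω n) : W ω 1 = √(n : ℝ) * E.μ₂ n ω / M.σ₂ P - h₂ := by
    change √(n : ℝ) * (E.μ₂ n ω - M.μ₂ P) / M.σ₂ P = _
    rw [hh₂]
    ring
  have hgood (ω : Ω n) (hω : ω ∉ B) : 0 < E.σ₁ n ω ∧ 0 < E.σ₂ n ω ∧
      |κ (E.ρ n ω) * (E.σ₁ n ω / M.σ₁ P) - κ r| ≤ η ∧
      |κ (E.ρ n ω) * (E.σ₂ n ω / M.σ₂ P) - κ r| ≤ η := by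
    simp only [B, Set.mem_union, Set.mem_ofPred_eq, not_or, not_le] at hω
    obtain ⟨⟨g1, g2⟩, g3⟩ := hω
    have hρE := E.abs_ρ_le_one n ω
    have hc : |κ (E.ρ n ω)| ≤ b := by
      rw [abs_of_pos (hκ₀ _ hρE)]
      exact hb (abs_le.1 hρE)
    have hcκ : |κ (E.ρ n ω) - κ r| ≤ η / 2 := (hκδ _ (abs_le.1 hρE) _ (abs_le.1 hr) g3).le
    have hpos {s σ : ℝ} (hσ : 0 < σ) (g : |s / σ - 1| < ζ) : 0 < s := by
      have h1 := (abs_lt.1 g).1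
      have h2 : ζ ≤ 1 / 2 := min_le_left _ _
      have h3 : 0 < s / σ := by linarith
      exact (div_pos_iff_of_pos_right hσ).1 h3
    exact ⟨hpos s₁ g1, hpos s₂ g2,
      abs_mul_sub_le_of_close hc hcκ hb0 (g1.le.trans (min_le_right _ _)),
      abs_mul_sub_le_of_close hc hcκ hb0 (g2.le.trans (min_le_right _ _))⟩
  -- The effective critical values are within η of κ r; the second η turns the weak rejection
  -- inequality into a strict one.
  have hupper : R ⊆ W ⁻¹' quadrantSet h₁ h₂ (κ r - 2 * η) ∪ B := by
    rintro ω ⟨hsign, hcrit⟩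
    by_cases hωB : ω ∈ B
    · exact Or.inr hωB
    obtain ⟨p1, p2, k1, k2⟩ := hgood ω hωB
    rw [mul_min_of_nonneg _ _ hn0.le, le_min_iff, le_mul_abs_div_iff hn0.le p1 s₁,
      le_mul_abs_div_iff hn0.le p2 s₂] at hcrit
    rw [abs_le] at k1 k2
    left
    rw [Set.mem_preimage, quadrantSet, Set.mem_union, Set.mem_ofPred_eq, Set.mem_ofPred_eq,
      hW0, hW1]
    rcases mul_neg_iff.1 hsign with ⟨m1, m2⟩ | ⟨m1, m2⟩
    · rw [abs_of_pos (div_pos (mul_pos hn0 m1) s₁),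
        abs_of_neg (div_neg_of_neg_of_pos (mul_neg_of_pos_of_neg hn0 m2) s₂)] at hcrit
      exact Or.inl ⟨by linarith, by linarith⟩
    · rw [abs_of_neg (div_neg_of_neg_of_pos (mul_neg_of_pos_of_neg hn0 m1) s₁),
        abs_of_pos (div_pos (mul_pos hn0 m2) s₂)] at hcrit
      exact Or.inr ⟨by linarith, by linarith⟩
  have hlower : W ⁻¹' quadrantSet h₁ h₂ (κ r + η) ⊆ R ∪ B := by
    intro ω hω
    by_cases hωB : ω ∈ B
    · exact Or.inr hωB
    obtain ⟨p1, p2, k1, k2⟩ := hgood ω hωB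
    rw [abs_le] at k1 k2
    have hpos {m σ : ℝ} (hσ : 0 < σ) (h : 0 < √(n : ℝ) * m / σ) : 0 < m :=
      (mul_pos_iff_of_pos_left hn0).1 ((div_pos_iff_of_pos_right hσ).1 h)
    have hneg {m σ : ℝ} (hσ : 0 < σ) (h : √(n : ℝ) * m / σ < 0) : m < 0 := by
      have := hpos (m := -m) hσ (by rw [mul_neg, neg_div]; linarith)
      linarith
    left
    rw [Set.mem_preimage, quadrantSet, Set.mem_union, Set.mem_ofPred_eq, Set.mem_ofPred_eq,
      hW0, hW1] at hω
    rw [hR, rejectionEvent, Set.mem_ofPred_eq, mul_min_of_nonneg _ _ hn0.le, le_min_iff,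
      le_mul_abs_div_iff hn0.le p1 s₁, le_mul_abs_div_iff hn0.le p2 s₂]
    rcases hω with ⟨w1, w2⟩ | ⟨w2, w1⟩
    · have t1 : 0 < √(n : ℝ) * E.μ₁ n ω / M.σ₁ P := by linarith
      have t2 : √(n : ℝ) * E.μ₂ n ω / M.σ₂ P < 0 := by linarith
      refine ⟨mul_neg_of_pos_of_neg (hpos s₁ t1) (hneg s₂ t2), ?_⟩
      rw [abs_of_pos t1, abs_of_neg t2]
      constructor <;> linarith
    · have t1 : √(n : ℝ) * E.μ₁ n ω / M.σ₁ P < 0 := by linarith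
      have t2 : 0 < √(n : ℝ) * E.μ₂ n ω / M.σ₂ P := by linarith
      refine ⟨mul_neg_of_neg_of_pos (hneg s₁ t1) (hpos s₂ t2), ?_⟩
      rw [abs_of_neg t1, abs_of_pos t2]
      constructor <;> linarith
  -- The upper error is 3ε for the bad event, 4ε for the quadrants, and 2 · 3η ≤ 6ε for moving c, in
  -- total 13ε.
  have u1 := (measureReal_mono hupper (μ := M.law P n)).trans (measureReal_union_le _ _)
  have u2 := (abs_le.1 (hquad (κ r - 2 * η) (by linarith))).2
  have u3 := quadrantSet_le_power r h₁ h₂ (c := κ r - 3 * η) (c' := κ r - 2 * η)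
    (by linarith) (by linarith)
  have u4 := power_le_power_add hr h₁ h₂ (c := κ r - 3 * η) (c' := κ r) (by linarith)
  have l1 := (measureReal_mono hlower (μ := M.law P n)).trans (measureReal_union_le _ _)
  have l2 := (abs_le.1 (hquad (κ r + η) (by linarith))).1
  have l3 := power_le_quadrantSet r h₁ h₂ (c := κ r + η) (by linarith)
  have l4 := power_le_power_add hr h₁ h₂ (c := κ r) (c' := κ r + η) (by linarith)
  rw [abs_le]
  constructor <;> linarith

theorem testSize_ne_top (M : StatModel DGP Ω) (E : Estimators Ω) (c : (n : ℕ) → Ω n → ℝ) (n : ℕ) :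
    testSize M E c n ≠ ⊤ :=
  ((iSup₂_le fun _ _ => prob_le_one).trans_lt ENNReal.one_lt_top).ne

/-- A feasible test whose critical value is a continuous positive function of the estimated
correlation, correct at every correlation in the class, has asymptotic size `α`. -/
theorem tendsto_testSize {M : StatModel DGP Ω} {E : Estimators Ω} (hcover : CoversNull M)
    (hCLT : UniformCLT M E) (hcons : UniformlyConsistent M E) {κ : ℝ → ℝ} {α : ℝ} (hα : 0 < α)
    (hκ : ContinuousOn κ (Set.Icc (-1) 1)) (hκ₀ : ∀ r, |r| ≤ 1 → 0 < κ r)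
    (hκα : ∀ P, maxPower (M.ρ P) (κ (M.ρ P)) = α) :
    Tendsto (testSize M E fun n ω => κ (E.ρ n ω)) atTop (𝓝 (ENNReal.ofReal α)) := by
  rw [← ENNReal.tendsto_toReal_iff (testSize_ne_top M E _) ENNReal.ofReal_ne_top,
    ENNReal.toReal_ofReal hα.le, Metric.tendsto_nhds]
  intro ε hε
  obtain ⟨s₁, s₂, r, hP⟩ := hcover
  obtain ⟨P₀, -, -, -, hs₂, hr⟩ := hP 0 0 (by simp)
  have hs₂0 : 0 < s₂ := hs₂ ▸ M.σ₂_pos P₀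
  obtain ⟨m, hm, hmα⟩ := exists_lt_power (r := r) (c := κ r) (a := α - ε / 3)
    (by rw [← hr, hκα]; linarith)
  filter_upwards [eventually_abs_rejection_sub_power_le hCLT hcons hκ hκ₀
    (show 0 < ε / 39 by positivity), eventually_gt_atTop 0] with n hn hn0
  have hsqrt : 0 < √(n : ℝ) := Real.sqrt_pos.2 (Nat.cast_pos.2 hn0)
  have hle : (testSize M E (fun n ω => κ (E.ρ n ω)) n).toReal ≤ α + ε / 3 := by
    refine ENNReal.toReal_le_of_le_ofReal (by positivity) (iSup₂_le fun P hnull => ?_)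
    rw [← ofReal_measureReal]
    apply ENNReal.ofReal_le_ofReal
    have h1 := (abs_le.1 (hn P)).2
    have h2 : 0 ≤ (√n * M.μ₁ P / M.σ₁ P) * (√n * M.μ₂ P / M.σ₂ P) := by
      have := M.σ₁_pos P
      have := M.σ₂_pos P
      rw [show (√n * M.μ₁ P / M.σ₁ P) * (√n * M.μ₂ P / M.σ₂ P)
        = (M.μ₁ P * M.μ₂ P) * (√n * √n / (M.σ₁ P * M.σ₂ P)) by ring]
      positivity
    have h3 := power_le_maxPower_of_mul_nonneg (M.abs_ρ_le_one P) h2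
      (hκ₀ _ (M.abs_ρ_le_one P)).le
    rw [hκα] at h3
    linarith
  have hge : α - 2 * ε / 3 ≤ (testSize M E (fun n ω => κ (E.ρ n ω)) n).toReal := by
    -- A process drifting with n, whose local parameters are exactly (0, m) with m nearly maximizing
    -- the power.
    obtain ⟨P, e1, e2, e3, e4, e5⟩ := hP 0 (m * s₂ / √n) (by simp)
    have h1 := (abs_le.1 (hn P)).1
    have h2 : √(n : ℝ) * (m * s₂ / √n) / s₂ = m := by field_simp
    rw [e1, e2, e4, e5, h2, mul_zero, zero_div] at h1
    have h3 : (M.law P n).real (rejectionEvent E (fun n ω => κ (E.ρ n ω)) n)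
        ≤ (testSize M E (fun n ω => κ (E.ρ n ω)) n).toReal :=
      ENNReal.toReal_mono (testSize_ne_top M E _ n)
        (le_iSup₂ (f := fun (P : DGP) (_ : 0 ≤ M.μ₁ P * M.μ₂ P) =>
          M.law P n (rejectionEvent E (fun n ω => κ (E.ρ n ω)) n)) P (by simp [e1]))
    linarith
  rw [Real.dist_eq, abs_lt]
  constructor <;> linarith

end Asymptotics

end SignCongruence

theorem mainTheorem4 {DGP : Type*} {Ω : ℕ → Type*} [∀ n, MeasurableSpace (Ω n)]
    (M : SignCongruence.StatModel DGP Ω) (E : SignCongruence.Estimators Ω)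
    (hcover : SignCongruence.CoversNull M)
    (hCLT : SignCongruence.UniformCLT M E)
    (hcons : SignCongruence.UniformlyConsistent M E)
    (α : ℝ) (hα₀ : 0 < α) (hα₁ : α < 1 / 2) :
    -- known nonnegative correlation: critical value `Φ⁻¹(1 - α)`
    ((∀ P, 0 ≤ M.ρ P) →
      Tendsto (SignCongruence.testSize M E
        (fun _ _ => SignCongruence.stdNormalQuantile (1 - α))) atTop (𝓝 (ENNReal.ofReal α))) ∧
    -- the equation defining the critical value has exactly one solution
    (∀ r : ℝ, |r| ≤ 1 → ∃! c : ℝ, SignCongruence.IsCriticalValue α r c) ∧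
    -- general case: plug-in critical value
    (∀ c : (n : ℕ) → Ω n → ℝ,
      (∀ n ω, SignCongruence.IsCriticalValue α (E.ρ n ω) (c n ω)) →
      Tendsto (SignCongruence.testSize M E c) atTop (𝓝 (ENNReal.ofReal α))) := by
  open SignCongruence in
  refine ⟨fun hρ => ?_, fun r hr => ?_, fun c hc => ?_⟩
  · obtain ⟨hq, hqα⟩ := gaussianReal_Iio_neg_quantile hα₀ hα₁
    exact tendsto_testSize hcover hCLT hcons (κ := fun _ => stdNormalQuantile (1 - α)) hα₀
      continuousOn_const (fun _ _ => hq)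
      fun P => (maxPower_eq_of_nonneg (M.abs_ρ_le_one P) (hρ P) hq.le).trans hqα
  · simp_rw [isCriticalValue_iff hα₀.le]
    exact existsUnique_maxPower_eq hr hα₀ hα₁
  -- By uniqueness, any solution is the one continuous function of the estimated correlation.
  · have hcκ : c = fun n ω => criticalValue α (E.ρ n ω) := by
      funext n ω
      have hr := E.abs_ρ_le_one n ω
      exact (existsUnique_maxPower_eq hr hα₀ hα₁).unique
        ((isCriticalValue_iff hα₀.le).1 (hc n ω)) (maxPower_criticalValue hr hα₀ hα₁)
    rw [hcκ]
    exact tendsto_testSize hcover hCLT hcons hα₀ (continuousOn_criticalValue hα₀ hα₁)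
      (fun r hr => pos_of_maxPower_eq hr hα₁ (maxPower_criticalValue hr hα₀ hα₁))
      fun P => maxPower_criticalValue (M.abs_ρ_le_one P) hα₀ hα₁
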